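/- Let $F$ be an algebraic extension of $\mathbb{Q}$ with algebraic closure $\overline{F}$ and absolute Galois group $G_F=\mathrm{Gal}(\overline{F}/F)$, let $E/F$ be an elliptic curve, let $n\geq 1$ be an integer, and let $\zeta_n\in\overline{F}$ be a primitive $n$-th root of unity. Let $E[n]\subseteq E(\overline{F})$ be the subgroup of points whose order divides $n$, and let $F(E[n])\subseteq\overline F$ be the field generated over $F$ by the $x$- and $y$-coordinates of the nonzero points of $E[n]$. Then $E[n]$ is a free $\mathbb{Z}/n\mathbb{Z}$-module of rank $2$. Moreover, choose any basis of $E[n]$, let $\rho_{E,n}\colon G_F\to \mathrm{GL}_2(\mathbb{Z}/n\mathbb{Z})$ be the homomorphism giving the action of $G_F$ on $E[n]$ in this basis, and set $G:=\rho_{E,n}(G_F)$. Then: (a) $G$ is abelian if and only if $F(E[n])/F$ is an abelian (Galois) extension. (b) $G\cap \mathrm{SL}_2(\mathbb{Z}/n\mathbb{Z})=1$ if and only if $F(E[n])=F(\zeta_n)$. In this case, $G$ is abelian and $\det\colon G\to(\mathbb{Z}/n\mathbb{Z})^\times$ is injective. -/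

import Mathlib

noncomputable section

open scoped Classical in
/-- The group `E(F̄)` of points of `E` over the algebraic closure `F̄` of `F`. -/
abbrev GeomPoint {F : Type*} [Field F] (E : WeierstrassCurve F) : Type _ :=
  (E.baseChange (AlgebraicClosure F)).toAffine.Point

open scoped Classical in
instance GeomPoint.instAddCommGroup {F : Type*} [Field F] (E : WeierstrassCurve F) :
    AddCommGroup (GeomPoint E) :=
  inferInstanceAs (AddCommGroup (E.baseChange (AlgebraicClosure F)).toAffine.Point)

/-- The `n`-torsion subgroup `E[n] = {P ∈ E(F̄) | nP = O}`. -/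
abbrev torsionPoints {F : Type*} [Field F] (E : WeierstrassCurve F) (n : ℕ) :
    AddSubgroup (GeomPoint E) :=
  AddSubgroup.torsionBy (GeomPoint E) (n : ℤ)

/-- `E[n]` as a module over `ℤ/nℤ`. -/
instance torsionPoints.instModule {F : Type*} [Field F] (E : WeierstrassCurve F) (n : ℕ) :
    Module (ZMod n) (torsionPoints E n) :=
  AddSubgroup.torsionBy.zmodModule

open scoped Classical in
/-- The action of `σ ∈ G_F = Gal(F̄/F)` on `E(F̄)`: `(x, y) ↦ (σ x, σ y)` and `O ↦ O`. -/
def galoisPointHom {F : Type*} [Field F] (E : WeierstrassCurve F)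
    (σ : Gal(AlgebraicClosure F/F)) : GeomPoint E →+ GeomPoint E :=
  WeierstrassCurve.Affine.Point.map (W' := E) (σ : AlgebraicClosure F →ₐ[F] AlgebraicClosure F)

theorem galoisPointHom_mem {F : Type*} [Field F] (E : WeierstrassCurve F) (n : ℕ)
    (σ : Gal(AlgebraicClosure F/F)) (P : torsionPoints E n) :
    galoisPointHom E σ P ∈ torsionPoints E n := by
  have hP := AddSubgroup.torsionBy.nsmul_iff.mp P.2
  rw [AddSubgroup.torsionBy.nsmul_iff, ← map_nsmul, hP, map_zero]

/-- The action of `G_F` on `E[n]`, a homomorphism from `G_F` to the monoid of `ℤ/nℤ`-linear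
endomorphisms of `E[n]`. -/
def galoisTorsionHom {F : Type*} [Field F] (E : WeierstrassCurve F) (n : ℕ) :
    Gal(AlgebraicClosure F/F) →* Module.End (ZMod n) (torsionPoints E n) where
  toFun σ := AddMonoidHom.toZModLinearMap n
    (((galoisPointHom E σ).comp (torsionPoints E n).subtype).codRestrict (torsionPoints E n)
      (galoisPointHom_mem E n σ))
  map_one' := by
    ext P
    obtain ⟨P, hP⟩ := P
    change galoisPointHom E 1 P = P
    cases P <;> rfl
  map_mul' σ τ := by
    ext P
    obtain ⟨P, hP⟩ := P
    change galoisPointHom E (σ * τ) P = galoisPointHom E σ (galoisPointHom E τ P)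
    cases P <;> rfl

/-- The mod-`n` Galois representation `ρ_{E,n} : G_F → GL₂(ℤ/nℤ)` with respect to a basis `b` of
`E[n]`: `σ` goes to the matrix, in the basis `b`, of the action of `σ` on `E[n]`. -/
def modGaloisRep {F : Type*} [Field F] (E : WeierstrassCurve F) (n : ℕ)
    (b : Module.Basis (Fin 2) (ZMod n) (torsionPoints E n)) :
    Gal(AlgebraicClosure F/F) →* Matrix.GeneralLinearGroup (Fin 2) (ZMod n) :=
  MonoidHom.toHomUnits
    ((LinearMap.toMatrixAlgEquiv b : _ →* Matrix (Fin 2) (Fin 2) (ZMod n)).comp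
      (galoisTorsionHom E n))

/-- The `n`-division field `F(E[n]) ⊆ F̄`, generated over `F` by the `x`- and `y`-coordinates of
all affine points in `E[n]`. -/
def divisionField {F : Type*} [Field F] (E : WeierstrassCurve F) (n : ℕ) :
    IntermediateField F (AlgebraicClosure F) :=
  IntermediateField.adjoin F
    {z | ∃ (x y : AlgebraicClosure F)
      (h : (E.baseChange (AlgebraicClosure F)).toAffine.Nonsingular x y),
      (WeierstrassCurve.Affine.Point.some x y h : GeomPoint E) ∈ torsionPoints E n ∧
        (z = x ∨ z = y)}

end

/-! The theorem rests on two computations of kernels in `G_F`: `ρ` has as kernel the fixing subgroup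
of `F(E[n])` (`modGaloisRep_eq_one_iff`), and `det ∘ ρ` that of `F(ζ)`
(`det_modGaloisRep_eq_one_iff`), because the determinant of `ρ` is the cyclotomic character. The
first identifies `G` with the Galois group of `F(E[n])/F`, whence (a). The condition `G ∩ SL₂ = 1`
says that the two kernels coincide, which by the Galois correspondence is the equality of fields in
(b); then `det` is injective on `G`, so `G` is abelian.

The geometric inputs, freeness of `E[n]` and the Weil pairing, are proved over an algebraically
closed field of characteristic zero.

Freeness: the symmetric functions of `x(P + Q)` and `x(P - Q)` are rational in `x(P)` and `x(Q)`
(`addSubMap_sym2x`). This yields a two-term recursion showing that multiplication by `n` acts on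
`x`-coordinates through a rational function of degree `n²` (`exists_isMulXDegree`). Hence points are
divisible and a generic fibre has `n²` points, so `E[n]` has order `n²` for every `n`
(`card_nsmul_eq_zero`), and group theory gives a basis.

Weil pairing: the valuation at `O` on the function field is carried to every point by translations.
Functions without poles are constant, and `(P) + (Q) - (P + Q) - (O)` is principal. For `T` in
`E[n]` there is thus a `g` whose divisor is the pullback of `(T) - (O)` under multiplication by `n`,
and `g(X + S) / g(X)` is a constant, the pairing of `S` and `T`. It is bilinear, alternating,
nondegenerate and Galois-equivariant. Its value at a basis is therefore a primitive `n`-th root of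
unity, which `σ` raises to the power `det ρ(σ)`. -/

namespace WeierstrassCurve

open WeierstrassCurve.Affine WeierstrassCurve.Affine.Point

/-! ### The `x`-coordinates of `P + Q` and `P - Q` -/

section AddSub

variable {K : Type*} [Field K]

lemma eval_addSubMap (W : WeierstrassCurve K) (v : Fin 3 → K) :
    (fun i => (W.addSubMap i).eval v) =
      ![v 0 ^ 2 - W.b₄ * v 0 * v 2 - W.b₆ * v 1 * v 2 - W.b₈ * v 2 ^ 2,
        2 * v 1 * v 0 + W.b₂ * v 0 * v 2 + W.b₄ * v 1 * v 2 + W.b₆ * v 2 ^ 2,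
        v 1 ^ 2 - 4 * v 0 * v 2] := by
  funext i
  fin_cases i <;> simp [addSubMap]

/-- The right side is the square of `2y + a₁x + a₃`, the denominator of the tangent slope, so this
is the denominator of `x(2P)`. -/
lemma four_mul_equation {R : Type*} [CommRing R] {W : WeierstrassCurve R} {x y : R}
    (h : W.toAffine.Equation x y) :
    4 * x ^ 3 + W.b₂ * x ^ 2 + 2 * W.b₄ * x + W.b₆ = (y - W.toAffine.negY x y) ^ 2 := by
  have h := (equation_iff ..).mp h
  simp only [b₂, b₄, b₆, negY]
  linear_combination -4 * h

lemma duplication_numerator {R : Type*} [CommRing R] {W : WeierstrassCurve R} {x y : R}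
    (h : W.toAffine.Equation x y) :
    x ^ 4 - W.b₄ * x ^ 2 - 2 * W.b₆ * x - W.b₈ =
      (3 * x ^ 2 + 2 * W.a₂ * x + W.a₄ - W.a₁ * y) ^ 2 +
        W.a₁ * (3 * x ^ 2 + 2 * W.a₂ * x + W.a₄ - W.a₁ * y) * (y - W.toAffine.negY x y) -
        (W.a₂ + 2 * x) * (y - W.toAffine.negY x y) ^ 2 := by
  have h := (equation_iff ..).mp h
  simp only [b₄, b₆, b₈, negY]
  linear_combination (8 * x + W.a₁ ^ 2 + 4 * W.a₂) * h

/-- The summands are `x(P + Q)` and `x(P - Q)` times `(x₁ - x₂)²`, since passing to `-Q` replaces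
`y₂` by `negY x₂ y₂`. Symmetry under `Q ↦ -Q` is what eliminates the `y`-coordinates. -/
lemma addX_add_subX {R : Type*} [CommRing R] {W : WeierstrassCurve R} {x₁ y₁ x₂ y₂ : R}
    (h₁ : W.toAffine.Equation x₁ y₁) (h₂ : W.toAffine.Equation x₂ y₂) :
    ((y₁ - y₂) ^ 2 + W.a₁ * (y₁ - y₂) * (x₁ - x₂) - (W.a₂ + x₁ + x₂) * (x₁ - x₂) ^ 2) +
      ((y₁ - W.toAffine.negY x₂ y₂) ^ 2 + W.a₁ * (y₁ - W.toAffine.negY x₂ y₂) * (x₁ - x₂) -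
        (W.a₂ + x₁ + x₂) * (x₁ - x₂) ^ 2) =
      2 * (x₁ + x₂) * (x₁ * x₂) + W.b₂ * (x₁ * x₂) + W.b₄ * (x₁ + x₂) + W.b₆ := by
  have e₁ := (equation_iff ..).mp h₁
  have e₂ := (equation_iff ..).mp h₂
  simp only [b₂, b₄, b₆, negY]
  linear_combination 2 * e₁ + 2 * e₂

/-- The left side is `x(P + Q) x(P - Q) (x₁ - x₂)⁴`; the surplus factor `(x₁ - x₂)²` on the right is
cancelled in `addSubMap_sym2x`. -/
lemma addX_mul_subX {R : Type*} [CommRing R] {W : WeierstrassCurve R} {x₁ y₁ x₂ y₂ : R}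
    (h₁ : W.toAffine.Equation x₁ y₁) (h₂ : W.toAffine.Equation x₂ y₂) :
    ((y₁ - y₂) ^ 2 + W.a₁ * (y₁ - y₂) * (x₁ - x₂) - (W.a₂ + x₁ + x₂) * (x₁ - x₂) ^ 2) *
      ((y₁ - W.toAffine.negY x₂ y₂) ^ 2 + W.a₁ * (y₁ - W.toAffine.negY x₂ y₂) * (x₁ - x₂) -
        (W.a₂ + x₁ + x₂) * (x₁ - x₂) ^ 2) =
      (x₁ - x₂) ^ 2 * ((x₁ * x₂) ^ 2 - W.b₄ * (x₁ * x₂) - W.b₆ * (x₁ + x₂) - W.b₈) := by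
  have e₁ := (equation_iff ..).mp h₁
  have e₂ := (equation_iff ..).mp h₂
  simp only [b₄, b₆, b₈, negY]
  linear_combination (x₁ - x₂) ^ 2 * (-4 * (x₁ + x₂) - (W.a₁ ^ 2 + 4 * W.a₂)) * e₁ +
    ((x₁ - x₂) * W.a₄ + (y₁ ^ 2 - y₂ ^ 2 + W.a₁ * x₁ * y₁ - W.a₁ * x₂ * y₂ + W.a₃ * (y₁ - y₂) -
      (x₁ ^ 3 - x₂ ^ 3) - W.a₂ * (x₁ ^ 2 - x₂ ^ 2)) + (x₁ - x₂) * (-2 * x₁ * x₂ +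
      4 * x₁ * (x₁ + x₂) + (W.a₁ ^ 2 + 4 * W.a₂) * x₁ + W.a₁ * W.a₃)) * (e₁ - e₂)

variable [DecidableEq K] {W : WeierstrassCurve K}

/-- The addition-and-subtraction map for a point and itself. -/
lemma addSubMap_sym2x_self [W.IsElliptic] (P : W.toAffine.Point) :
    ∃ k : K, k ≠ 0 ∧ (fun i => (W.addSubMap i).eval (P.sym2x P)) = k • (P + P).sym2x 0 := by
  match P with
  | 0 => exact ⟨1, one_ne_zero, by rw [eval_addSubMap, add_zero]; simp⟩
  | .some x y h =>
    have hev : (fun i => (W.addSubMap i).eval (sym2x (.some x y h) (.some x y h))) =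
        ![x ^ 4 - W.b₄ * x ^ 2 - 2 * W.b₆ * x - W.b₈, (y - W.toAffine.negY x y) ^ 2, 0] := by
      rw [eval_addSubMap, ← four_mul_equation h.1]
      ext i
      fin_cases i <;> simp <;> ring
    by_cases hy : y = W.toAffine.negY x y
    -- At a 2-torsion point the denominator vanishes. The numerator then cannot, as the map has no
    -- base points on an elliptic curve, and it serves as the scalar.
    · have hne := addSubMap_ne_zero W (sym2x_ne_zero (.some x y h) (.some x y h))
      rw [hev] at hne ⊢
      rw [add_self_of_Y_eq hy]
      rw [sub_eq_zero.mpr hy] at hne ⊢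
      refine ⟨x ^ 4 - W.b₄ * x ^ 2 - 2 * W.b₆ * x - W.b₈, ?_, ?_⟩
      · intro h0
        exact hne (by simp [h0])
      · simp
    · have hψ : y - W.toAffine.negY x y ≠ 0 := sub_ne_zero.mpr hy
      rw [hev, add_self_of_Y_ne hy]
      refine ⟨(y - W.toAffine.negY x y) ^ 2, pow_ne_zero 2 hψ, ?_⟩
      have hX : (y - W.toAffine.negY x y) ^ 2 *
          W.toAffine.addX x x (W.toAffine.slope x x y y) =
            x ^ 4 - W.b₄ * x ^ 2 - 2 * W.b₆ * x - W.b₈ := by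
        rw [duplication_numerator h.1, slope_of_Y_ne rfl hy, addX]
        field_simp
        ring
      simp [-addX, -negY, hX]

/-- The addition-and-subtraction map sends `(x(P)x(Q) : x(P) + x(Q) : 1)` to
`(x(P + Q)x(P - Q) : x(P + Q) + x(P - Q) : 1)`. -/
lemma addSubMap_sym2x [W.IsElliptic] (P Q : W.toAffine.Point) :
    ∃ k : K, k ≠ 0 ∧
      (fun i => (W.addSubMap i).eval (P.sym2x Q)) = k • (P + Q).sym2x (P - Q) := by
  by_cases hPQ : P = Q
  · subst hPQ
    simpa using addSubMap_sym2x_self P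
  by_cases hPQ' : P = -Q
  · subst hPQ'
    obtain ⟨k, hk, h⟩ := addSubMap_sym2x_self Q
    refine ⟨k, hk, ?_⟩
    rw [sym2x_neg_left, h, neg_add_cancel, sym2x_comm, ← sym2x_neg_right, neg_add, sub_eq_add_neg]
  match P, Q with
  | 0, 0 => exact absurd rfl hPQ
  | 0, .some x y h =>
    refine ⟨1, one_ne_zero, ?_⟩
    rw [zero_add, zero_sub, sym2x_neg_right, eval_addSubMap]
    ext i
    fin_cases i <;> simp <;> ring
  | .some x y h, 0 =>
    refine ⟨1, one_ne_zero, ?_⟩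
    rw [add_zero, sub_zero, eval_addSubMap]
    ext i
    fin_cases i <;> simp <;> ring
  | .some x₁ y₁ h₁, .some x₂ y₂ h₂ =>
    have hx : x₁ ≠ x₂ := fun hx => (X_eq_iff.mp hx).elim hPQ hPQ'
    have hx' : x₁ - x₂ ≠ 0 := sub_ne_zero.mpr hx
    refine ⟨(x₁ - x₂) ^ 2, pow_ne_zero 2 hx', ?_⟩
    rw [sub_eq_add_neg (Point.some x₁ y₁ h₁), neg_some, add_of_X_ne hx, add_of_X_ne hx,
      eval_addSubMap]
    have hX (y : K) : W.toAffine.addX x₁ x₂ (W.toAffine.slope x₁ x₂ y₁ y) * (x₁ - x₂) ^ 2 =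
        (y₁ - y) ^ 2 + W.a₁ * (y₁ - y) * (x₁ - x₂) - (W.a₂ + x₁ + x₂) * (x₁ - x₂) ^ 2 := by
      rw [slope_of_X_ne hx, addX]
      field_simp
      ring
    have hsum := addX_add_subX h₁.1 h₂.1
    have hprod := addX_mul_subX h₁.1 h₂.1
    rw [← hX, ← hX] at hsum hprod
    simp only [sym2x_some_some]
    ext i
    fin_cases i
    · simp [-addX, -negY]
      apply mul_left_cancel₀ (pow_ne_zero 2 hx')
      linear_combination -hprod
    · simp [-addX, -negY]
      linear_combination -hsum
    · simp; ring

end AddSub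

end WeierstrassCurve

/-! ### Multiplication by `n` as a rational function of `x` -/

namespace WeierstrassCurve

open WeierstrassCurve.Affine WeierstrassCurve.Affine.Point Polynomial

section MulByInt

variable {K : Type*} [Field K]

/-- The equation is a monic quadratic in `y`. This allows polynomial identities in `x` to be checked
at points of the curve. -/
lemma exists_nonsingular [IsAlgClosed K] (W : WeierstrassCurve K) [W.IsElliptic] (x : K) :
    ∃ y, W.toAffine.Nonsingular x y := by
  have hd : (X ^ 2 + C (W.a₁ * x + W.a₃) * X -
      C (x ^ 3 + W.a₂ * x ^ 2 + W.a₄ * x + W.a₆) : K[X]).degree ≠ 0 := by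
    have : (X ^ 2 + C (W.a₁ * x + W.a₃) * X -
      C (x ^ 3 + W.a₂ * x ^ 2 + W.a₄ * x + W.a₆) : K[X]).degree = 2 := by compute_degree!
    rw [this]; decide
  obtain ⟨y, hy⟩ := IsAlgClosed.exists_root _ hd
  refine ⟨y, equation_iff_nonsingular.mp ((equation_iff ..).mpr ?_)⟩
  simp only [IsRoot.def, eval_sub, eval_add, eval_mul, eval_pow, eval_X, eval_C] at hy
  linear_combination hy

/-- The polynomials obtained by evaluating the addition-and-subtraction map at
`(A X : A + B X : B)`. -/
noncomputable def addSubPoly (W : WeierstrassCurve K) (A B : K[X]) : Fin 3 → K[X] :=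
  ![(A * X) ^ 2 - C W.b₄ * (A * X) * B - C W.b₆ * (A + B * X) * B - C W.b₈ * B ^ 2,
    2 * (A + B * X) * (A * X) + C W.b₂ * (A * X) * B + C W.b₄ * (A + B * X) * B + C W.b₆ * B ^ 2,
    (A - B * X) ^ 2]

variable [DecidableEq K]

/-- The rational function `A / B` represents the effect of multiplication by `n` on
`x`-coordinates. -/
def IsMulX (W : WeierstrassCurve K) (n : ℕ) (A B : K[X]) : Prop :=
  ∀ (x y : K) (h : W.toAffine.Nonsingular x y),
    ∃ k : K, k ≠ 0 ∧ ![A.eval x, B.eval x] = k • (n • Point.some x y h).xRep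

variable {W : WeierstrassCurve K}

lemma eval_addSubPoly [W.IsElliptic] {n : ℕ} {A B : K[X]} (hAB : W.IsMulX (n + 1) A B)
    {x y : K} (h : W.toAffine.Nonsingular x y) :
    ∃ k : K, k ≠ 0 ∧ (fun i => (W.addSubPoly A B i).eval x) =
      k • ((n + 2) • Point.some x y h).sym2x (n • Point.some x y h) := by
  obtain ⟨k, hk, hkn⟩ := hAB x y h
  obtain ⟨l, hl, hln⟩ := addSubMap_sym2x ((n + 1) • Point.some x y h) (.some x y h)
  -- The map is quadratic, and its argument is the symmetric product of `(n + 1)P` and `P` up to the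
  -- factor `k`.
  refine ⟨k ^ 2 * l, mul_ne_zero (pow_ne_zero 2 hk) hl, ?_⟩
  have h1 : (n + 1) • Point.some x y h + .some x y h = (n + 2) • Point.some x y h := by
    rw [← succ_nsmul]
  have h2 : (n + 1) • Point.some x y h - .some x y h = n • Point.some x y h := by
    rw [succ_nsmul, add_sub_cancel_right]
  rw [mul_smul, ← h1, ← h2, ← hln, eval_addSubMap]
  have hA := congrFun hkn 0
  have hB := congrFun hkn 1
  simp only [Matrix.cons_val_zero, Matrix.cons_val_one, Pi.smul_apply, smul_eq_mul] at hA hB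
  ext i
  fin_cases i <;> simp [addSubPoly, sym2x, hA, hB] <;> ring

lemma IsMulX.ne_zero {n : ℕ} {A B : K[X]} (hAB : W.IsMulX n A B) {x y : K}
    (h : W.toAffine.Nonsingular x y) : ![A.eval x, B.eval x] ≠ 0 := by
  obtain ⟨k, hk, hkn⟩ := hAB x y h
  rw [hkn]
  exact smul_ne_zero hk (xRep_ne_zero _)

/-- At a common root `x` the projective coordinates of `x(nP)` would both vanish. -/
lemma IsMulX.isCoprime [IsAlgClosed K] [W.IsElliptic] {n : ℕ} {A B : K[X]}
    (hAB : W.IsMulX n A B) : IsCoprime A B := by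
  rw [Polynomial.isCoprime_iff_aeval_ne_zero_of_isAlgClosed (k := K) K]
  intro x
  obtain ⟨y, h⟩ := W.exists_nonsingular x
  have := hAB.ne_zero h
  by_contra! h0
  simp only [coe_aeval_eq_eval] at h0
  exact this (by simp [h0])

/-- A symmetric product of two linear forms determines the second factor once the first one is
known. -/
lemma eq_smul_of_sym_eq {p q r : Fin 2 → K} (hp : p ≠ 0) {c : K}
    (h₀ : p 0 * q 0 = c * (p 0 * r 0)) (h₁ : p 0 * q 1 + p 1 * q 0 = c * (p 0 * r 1 + p 1 * r 0))
    (h₂ : p 1 * q 1 = c * (p 1 * r 1)) : q = c • r := by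
  by_cases hp₀ : p 0 = 0
  · have hp₁ : p 1 ≠ 0 := fun hp₁ => hp (by ext i; fin_cases i <;> assumption)
    rw [hp₀] at h₁
    ext i
    fin_cases i
    · exact mul_left_cancel₀ hp₁ (show p 1 * q 0 = p 1 * (c * r 0) by linear_combination h₁)
    · exact mul_left_cancel₀ hp₁ (show p 1 * q 1 = p 1 * (c * r 1) by linear_combination h₂)
  · have hq : q 0 = c * r 0 := mul_left_cancel₀ hp₀ (by linear_combination h₀)
    ext i
    fin_cases i
    · simpa using hq
    · exact mul_left_cancel₀ hp₀
        (show p 0 * q 1 = p 0 * (c * r 1) by linear_combination h₁ - p 1 * hq)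

/-- The addition-and-subtraction map at `(n + 1)P` and `P` gives the symmetric product of `nP` and
`(n + 2)P`; the known factor `nP` is divided out. -/
lemma IsMulX.step [W.IsElliptic] {n : ℕ} {A B A' B' A'' B'' : K[X]}
    (hAB : W.IsMulX (n + 1) A B) (hAB' : W.IsMulX n A' B')
    (h₀ : W.addSubPoly A B 0 = A' * A'') (h₁ : W.addSubPoly A B 1 = A' * B'' + B' * A'')
    (h₂ : W.addSubPoly A B 2 = B' * B'') : W.IsMulX (n + 2) A'' B'' := by
  intro x y h
  obtain ⟨k, hk, hkn⟩ := eval_addSubPoly hAB h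
  obtain ⟨l, hl, hln⟩ := hAB' x y h
  have hA := congrFun hln 0
  have hB := congrFun hln 1
  have e₀ := congrFun hkn 0
  have e₁ := congrFun hkn 1
  have e₂ := congrFun hkn 2
  refine ⟨k / l, div_ne_zero hk hl, eq_smul_of_sym_eq (p := ![A'.eval x, B'.eval x])
    (hAB'.ne_zero h) ?_ ?_ ?_⟩
  all_goals
    simp [h₀, h₁, h₂, sym2x] at hA hB e₀ e₁ e₂ ⊢
    simp only [hA, hB] at e₀ e₁ e₂ ⊢
    field_simp
  · linear_combination e₀
  · linear_combination e₁
  · linear_combination e₂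

/-- The pair `(A', B')` is a zero of the binary quadratic form whose coefficients are the three
polynomials (`hid`, verified at every point). Since `A'` and `B'` are coprime, they divide the outer
coefficients, and the quotients form the other linear factor. -/
lemma IsMulX.exists_factor [IsAlgClosed K] [W.IsElliptic] {n : ℕ} {A B A' B' : K[X]}
    (hAB : W.IsMulX (n + 1) A B) (hAB' : W.IsMulX n A' B') (hA' : A' ≠ 0) (hB' : B' ≠ 0) :
    ∃ A'' B'' : K[X], W.addSubPoly A B 0 = A' * A'' ∧
      W.addSubPoly A B 1 = A' * B'' + B' * A'' ∧ W.addSubPoly A B 2 = B' * B'' := by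
  have hid : W.addSubPoly A B 0 * B' ^ 2 - W.addSubPoly A B 1 * (A' * B') +
      W.addSubPoly A B 2 * A' ^ 2 = 0 := by
    refine Polynomial.funext fun x => ?_
    obtain ⟨y, h⟩ := W.exists_nonsingular x
    obtain ⟨k, -, hkn⟩ := eval_addSubPoly hAB h
    obtain ⟨l, -, hln⟩ := hAB' x y h
    have hA := congrFun hln 0
    have hB := congrFun hln 1
    have e₀ := congrFun hkn 0
    have e₁ := congrFun hkn 1
    have e₂ := congrFun hkn 2
    simp [sym2x] at hA hB e₀ e₁ e₂ ⊢
    rw [hA, hB, e₀, e₁, e₂]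
    ring
  have hcop := hAB'.isCoprime
  obtain ⟨A'', hA''⟩ : A' ∣ W.addSubPoly A B 0 := by
    refine (hcop.pow_right (n := 2)).dvd_of_dvd_mul_right
      ⟨W.addSubPoly A B 1 * B' - W.addSubPoly A B 2 * A', ?_⟩
    linear_combination hid
  obtain ⟨B'', hB''⟩ : B' ∣ W.addSubPoly A B 2 := by
    refine (hcop.symm.pow_right (n := 2)).dvd_of_dvd_mul_right
      ⟨W.addSubPoly A B 1 * A' - W.addSubPoly A B 0 * B', ?_⟩
    linear_combination hid
  refine ⟨A'', B'', hA'', ?_, hB''⟩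
  refine mul_left_cancel₀ (mul_ne_zero hA' hB') ?_
  rw [hA'', hB''] at hid
  linear_combination -hid

omit [DecidableEq K] in
lemma natDegree_addSubPoly_zero_lt (W : WeierstrassCurve K) {A B : K[X]} {d : ℕ}
    (hA : A.natDegree = d) (hB : B.natDegree < d) :
    (C W.b₄ * (A * X) * B + C W.b₆ * (A + B * X) * B + C W.b₈ * B ^ 2).natDegree < 2 * d + 2 := by
  have h1 : (A * X).natDegree ≤ d + 1 := natDegree_mul_le.trans (by simp [hA])
  have h2 : (A + B * X).natDegree ≤ d + 1 :=
    natDegree_add_le_of_degree_le (by omega) (natDegree_mul_le.trans (by simp; omega))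
  have h3 (c : K) : (C c * (A * X) * B).natDegree ≤ 2 * d + 1 := by
    rw [mul_assoc]
    exact (natDegree_C_mul_le _ _).trans (natDegree_mul_le.trans (by omega))
  have h4 (c : K) : (C c * (A + B * X) * B).natDegree ≤ 2 * d + 1 := by
    rw [mul_assoc]
    exact (natDegree_C_mul_le _ _).trans (natDegree_mul_le.trans (by omega))
  have h5 (c : K) : (C c * B ^ 2).natDegree ≤ 2 * d + 1 :=
    (natDegree_C_mul_le _ _).trans (natDegree_pow_le.trans (by omega))
  exact Nat.lt_succ_of_le (natDegree_add_le_of_degree_le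
    (natDegree_add_le_of_degree_le (h3 _) (h4 _)) (h5 _))

omit [DecidableEq K] in
lemma monic_addSubPoly_zero (W : WeierstrassCurve K) {A B : K[X]} {d : ℕ} (hAm : A.Monic)
    (hA : A.natDegree = d) (hB : B.natDegree < d) :
    (W.addSubPoly A B 0).Monic ∧ (W.addSubPoly A B 0).natDegree = 2 * d + 2 := by
  have hlt := natDegree_addSubPoly_zero_lt W hA hB
  have hm : ((A * X) ^ 2).Monic := (hAm.mul monic_X).pow 2
  have hd : ((A * X) ^ 2).natDegree = 2 * d + 2 := by
    rw [(hAm.mul monic_X).natDegree_pow, natDegree_mul_X hAm.ne_zero, hA]; ring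
  have heq : W.addSubPoly A B 0 = (A * X) ^ 2 -
      (C W.b₄ * (A * X) * B + C W.b₆ * (A + B * X) * B + C W.b₈ * B ^ 2) := by
    simp [addSubPoly]; ring
  have hlt' := degree_lt_degree (hlt.trans_eq hd.symm)
  rw [heq]
  exact ⟨hm.sub_of_left hlt', by rw [natDegree_sub_eq_left_of_natDegree_lt (by omega), hd]⟩

/-- Multiplication by a positive integer `n` on `x`-coordinates is given by a rational function of
degree `n ^ 2`. -/
structure IsMulXDegree (W : WeierstrassCurve K) (n : ℕ) (A B : K[X]) : Prop where
  isMulX : W.IsMulX n A B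
  monic : A.Monic
  natDegree : A.natDegree = n ^ 2
  natDegree_succ : B.natDegree + 1 = n ^ 2
  leadingCoeff : B.leadingCoeff = n ^ 2

lemma isMulX_zero : W.IsMulX 0 1 0 := fun x y h => ⟨1, one_ne_zero, by simp⟩

lemma isMulXDegree_one : W.IsMulXDegree 1 X 1 where
  isMulX x y h := ⟨1, one_ne_zero, by simp⟩
  monic := monic_X
  natDegree := by simp
  natDegree_succ := by simp
  leadingCoeff := by simp

/-- A separate base case: the general step divides by `B'`, which is `0` for multiplication by `0`,
and needs `A ≠ B X`, which fails for the identity. -/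
lemma isMulXDegree_two [CharZero K] [W.IsElliptic] :
    W.IsMulXDegree 2 (W.addSubPoly X 1 0) (W.addSubPoly X 1 1) := by
  have hd : (W.addSubPoly X 1 1).natDegree = 3 := by
    simp only [addSubPoly, Matrix.cons_val_one, Matrix.cons_val_zero]
    have : (2 * (X + 1 * X) * (X * X) + C W.b₂ * (X * X) * 1 + C W.b₄ * (X + 1 * X) * 1 +
      C W.b₆ * 1 ^ 2 : K[X]) = 4 * X ^ 3 + C W.b₂ * X ^ 2 + 2 * C W.b₄ * X + C W.b₆ := by ring
    rw [this]
    compute_degree!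
  obtain ⟨hm, hdm⟩ := monic_addSubPoly_zero W (A := X) (B := 1) (d := 1) monic_X (by simp) (by simp)
  refine ⟨?_, hm, by simpa using hdm, by simp [hd], ?_⟩
  · exact isMulXDegree_one.isMulX.step isMulX_zero (by ring) (by ring) (by simp [addSubPoly])
  · rw [Polynomial.leadingCoeff, hd]
    simp only [addSubPoly, Matrix.cons_val_one, Matrix.cons_val_zero]
    have : (2 * (X + 1 * X) * (X * X) + C W.b₂ * (X * X) * 1 + C W.b₄ * (X + 1 * X) * 1 +
      C W.b₆ * 1 ^ 2 : K[X]) = C 4 * X ^ 3 + C W.b₂ * X ^ 2 + C (2 * W.b₄) * X + C W.b₆ := by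
        simp only [map_mul, map_ofNat]; ring
    rw [this]
    simp
    norm_num

omit [DecidableEq K] in
lemma leadingCoeff_sub_mul_X {A B : K[X]} {d : ℕ} (hAm : A.Monic) (hA : A.natDegree = d)
    (hB : B.natDegree + 1 = d) (hl : B.leadingCoeff ≠ 1) :
    (A - B * X).natDegree = d ∧ (A - B * X).leadingCoeff = 1 - B.leadingCoeff := by
  have hc : (A - B * X).coeff d = 1 - B.leadingCoeff := by
    rw [coeff_sub, ← hB, coeff_mul_X, hB, ← hA]
    exact congrArg (· - _) hAm
  have hd : (A - B * X).natDegree = d := by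
    refine natDegree_eq_of_le_of_coeff_ne_zero ?_ ?_
    · have hBX : (B * X).natDegree ≤ d := natDegree_mul_le.trans (by rw [natDegree_X, hB])
      simpa using natDegree_sub_le_of_le hA.le hBX
    · rw [hc]; exact sub_ne_zero.mpr hl.symm
  exact ⟨hd, by rw [Polynomial.leadingCoeff, hd, hc]⟩

/-- The bookkeeping is `2(n+2)² + 2 = (n+1)² + (n+3)²` for degrees and `(1 - (n+2)²)² =
(n+1)²(n+3)²` for leading coefficients; characteristic zero keeps the latter nonzero. -/
lemma IsMulXDegree.step [CharZero K] [IsAlgClosed K] [W.IsElliptic] {n : ℕ} {A B A' B' : K[X]}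
    (h : W.IsMulXDegree (n + 2) A B) (h' : W.IsMulXDegree (n + 1) A' B') :
    ∃ A'' B'' : K[X], W.IsMulXDegree (n + 3) A'' B'' := by
  have hB' : B' ≠ 0 := by
    rw [← leadingCoeff_ne_zero, h'.leadingCoeff]
    exact pow_ne_zero 2 (Nat.cast_ne_zero.mpr n.succ_ne_zero)
  obtain ⟨A'', B'', h₀, h₁, h₂⟩ := h.isMulX.exists_factor h'.isMulX h'.monic.ne_zero hB'
  obtain ⟨hm, hdm⟩ := monic_addSubPoly_zero W h.monic h.natDegree
    (by rw [← h.natDegree_succ]; exact Nat.lt_succ_self _)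
  have hl : B.leadingCoeff ≠ 1 := by
    rw [h.leadingCoeff]
    have : ((n + 2) ^ 2 : ℕ) ≠ 1 := (Nat.one_lt_pow two_ne_zero (by omega)).ne'
    exact_mod_cast this
  obtain ⟨hd₂, hl₂⟩ := leadingCoeff_sub_mul_X h.monic h.natDegree h.natDegree_succ hl
  have hG₂ : W.addSubPoly A B 2 = (A - B * X) ^ 2 := rfl
  have hl₂' : B'.leadingCoeff * B''.leadingCoeff = (1 - B.leadingCoeff) ^ 2 := by
    rw [← leadingCoeff_mul, ← h₂, hG₂, leadingCoeff_pow, hl₂]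
  have hB'' : B'' ≠ 0 := by
    rintro rfl
    simp only [leadingCoeff_zero, mul_zero] at hl₂'
    exact pow_ne_zero 2 (sub_ne_zero.mpr hl.symm) hl₂'.symm
  have hd₂' : B'.natDegree + B''.natDegree = 2 * (n + 2) ^ 2 := by
    rw [← natDegree_mul hB' hB'', ← h₂, hG₂, natDegree_pow, hd₂]
  have hA'' : A''.Monic := h'.monic.of_mul_monic_left (h₀ ▸ hm)
  refine ⟨A'', B'', h.isMulX.step h'.isMulX h₀ h₁ h₂, hA'', ?_, ?_, ?_⟩
  · rw [h₀, h'.monic.natDegree_mul hA'', h'.natDegree] at hdm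
    nlinarith
  · have := h'.natDegree_succ
    nlinarith
  · have hn : ((n : K) + 1) ^ 2 ≠ 0 := pow_ne_zero 2 (Nat.cast_add_one_ne_zero n)
    refine mul_left_cancel₀ hn ?_
    rw [h'.leadingCoeff, h.leadingCoeff] at hl₂'
    push_cast at hl₂' ⊢
    rw [hl₂']
    ring

theorem exists_isMulXDegree [CharZero K] [IsAlgClosed K] (W : WeierstrassCurve K) [W.IsElliptic]
    {n : ℕ} (hn : 0 < n) : ∃ A B : K[X], W.IsMulXDegree n A B := by
  obtain ⟨n, rfl⟩ := Nat.exists_eq_succ_of_ne_zero hn.ne'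
  suffices (∃ A B : K[X], W.IsMulXDegree (n + 1) A B) ∧ ∃ A B : K[X], W.IsMulXDegree (n + 2) A B
    from this.1
  clear hn
  induction n with
  | zero => exact ⟨⟨_, _, isMulXDegree_one⟩, ⟨_, _, isMulXDegree_two⟩⟩
  | succ n ih =>
    obtain ⟨⟨A', B', h'⟩, ⟨A, B, h⟩⟩ := ih
    exact ⟨⟨A, B, h⟩, h.step h'⟩

end MulByInt

end WeierstrassCurve

/-! ### Divisibility and the order of `E[n]` -/

namespace WeierstrassCurve

open WeierstrassCurve.Affine WeierstrassCurve.Affine.Point Polynomial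

section Torsion

variable {K : Type*} [Field K] [DecidableEq K] [IsAlgClosed K] [CharZero K]
  {W : WeierstrassCurve K} [W.IsElliptic]

omit [IsAlgClosed K] [W.IsElliptic] in
-- A root says that `(A : B) = (x₀ : 1)` at `x`, and an `x`-coordinate determines a point up to
-- sign.
lemma IsMulX.eval_eq_iff {n : ℕ} {A B : K[X]} (hAB : W.IsMulX n A B) {x y x₀ y₀ : K}
    (h : W.toAffine.Nonsingular x y) (h₀ : W.toAffine.Nonsingular x₀ y₀) :
    (A - C x₀ * B).eval x = 0 ↔
      n • Point.some x y h = .some x₀ y₀ h₀ ∨ n • Point.some x y h = -.some x₀ y₀ h₀ := by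
  obtain ⟨k, hk, hkn⟩ := hAB x y h
  have h0 := congrFun hkn 0
  have h1 := congrFun hkn 1
  simp only [Matrix.cons_val_one, Matrix.cons_val_zero, Pi.smul_apply, smul_eq_mul] at h0 h1
  rw [← xRep_eq_xRep_iff, eval_sub, eval_mul, eval_C, h0, h1]
  cases n • Point.some x y h with
  | zero => simp [← zero_def, hk]
  | some x' y' h' =>
    simp only [xRep_some, Matrix.cons_val_one, Matrix.cons_val_zero, mul_one]
    rw [show k * x' - x₀ * k = k * (x' - x₀) by ring, mul_eq_zero, or_iff_right hk, sub_eq_zero]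
    simp

omit [IsAlgClosed K] [CharZero K] [W.IsElliptic] in
lemma IsMulXDegree.natDegree_sub {n : ℕ} {A B : K[X]} (h : W.IsMulXDegree n A B) (x₀ : K) :
    (A - C x₀ * B).Monic ∧ (A - C x₀ * B).natDegree = n ^ 2 := by
  have hlt : (C x₀ * B).natDegree < A.natDegree := by
    rw [h.natDegree, ← h.natDegree_succ]
    exact Nat.lt_succ_of_le (natDegree_C_mul_le _ _)
  exact ⟨h.monic.sub_of_left (degree_lt_degree hlt), by
    rw [natDegree_sub_eq_left_of_natDegree_lt hlt, h.natDegree]⟩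

theorem exists_nsmul_eq {n : ℕ} (hn : 0 < n) (P : W.toAffine.Point) : ∃ Q, n • Q = P := by
  match P with
  | 0 => exact ⟨0, smul_zero _⟩
  | .some x₀ y₀ h₀ =>
    obtain ⟨A, B, hAB⟩ := W.exists_isMulXDegree hn
    obtain ⟨hm, hd⟩ := hAB.natDegree_sub x₀
    obtain ⟨x, hx⟩ := IsAlgClosed.exists_root (A - C x₀ * B) (by
      rw [degree_eq_natDegree hm.ne_zero, hd]
      exact_mod_cast (pow_pos hn 2).ne')
    obtain ⟨y, h⟩ := W.exists_nonsingular x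
    rcases (hAB.isMulX.eval_eq_iff h h₀).mp hx with hQ | hQ
    · exact ⟨_, hQ⟩
    · exact ⟨-.some x y h, by rw [smul_neg, hQ, neg_neg]⟩

/-- For all but finitely many values of `x₀`, the rational function `A / B` takes the value `x₀`
with multiplicity one. -/
lemma IsMulXDegree.finite_not_separable {n : ℕ} {A B : K[X]} (h : W.IsMulXDegree n A B) :
    {x₀ : K | ¬(A - C x₀ * B).Separable}.Finite := by
  -- A double root `r` of `A - x₀B` is a root of this Wronskian and satisfies `x₀ = A(r)/B(r)`. The
  -- Wronskian is nonzero, since otherwise coprimality would make `A` divide its own derivative.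
  set D := derivative A * B - A * derivative B
  have hD : D ≠ 0 := by
    intro hD
    have hcop := h.isMulX.isCoprime
    have hdvd : A ∣ derivative A := by
      refine hcop.dvd_of_dvd_mul_right ⟨derivative B, ?_⟩
      linear_combination hD
    have hA : derivative A = 0 := by
      by_contra hA
      have hlt := degree_derivative_lt h.monic.ne_zero
      exact absurd (degree_le_of_dvd hdvd hA) (not_le.mpr hlt)
    have := Polynomial.derivative_eq_zero.mp hA
    have h1 := h.natDegree
    have h2 := h.natDegree_succ
    omega
  refine ((D.roots.toFinset.finite_toSet).image fun r => A.eval r / B.eval r).subset ?_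
  intro x₀ hx₀
  rw [Set.mem_ofPred_eq, Polynomial.separable_def,
    Polynomial.isCoprime_iff_aeval_ne_zero_of_isAlgClosed (k := K) K] at hx₀
  push Not at hx₀
  obtain ⟨r, hr, hr'⟩ := hx₀
  obtain ⟨y, hns⟩ := W.exists_nonsingular r
  simp only [coe_aeval_eq_eval, eval_sub, eval_mul, eval_C, derivative_sub, derivative_mul,
    derivative_C, zero_mul, zero_add] at hr hr'
  have hB : B.eval r ≠ 0 := by
    intro hB
    rw [hB, mul_zero, sub_zero] at hr
    exact h.isMulX.ne_zero hns (by simp [hr, hB])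
  refine ⟨r, ?_, ?_⟩
  · simp only [Finset.mem_coe, Multiset.mem_toFinset, mem_roots hD, IsRoot.def, D, eval_sub,
      eval_mul]
    linear_combination B.eval r * hr' - (derivative B).eval r * hr
  · simp only
    rw [div_eq_iff hB]
    linear_combination hr

omit [IsAlgClosed K] in
lemma finite_negY_eq (W : WeierstrassCurve K) :
    {x : K | ∃ y, W.toAffine.Equation x y ∧ y = W.toAffine.negY x y}.Finite := by
  set p : K[X] := C 4 * X ^ 3 + C W.b₂ * X ^ 2 + C (2 * W.b₄) * X + C W.b₆
  have hp : p ≠ 0 := by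
    intro hp
    have : p.coeff 3 = 4 := by simp [p]
    rw [hp, coeff_zero] at this
    norm_num at this
  refine p.roots.toFinset.finite_toSet.subset ?_
  rintro x ⟨y, hxy, hy⟩
  have := four_mul_equation hxy
  rw [sub_eq_zero.mpr hy] at this
  simp only [Finset.mem_coe, Multiset.mem_toFinset, mem_roots hp, IsRoot.def, p]
  simp
  linear_combination this

/-- All fibres of multiplication by `n` are translates of `E[n]`, so one good fibre is counted. Take
`x₀` such that `A - x₀B` has `n²` distinct roots and `P₀ ≠ -P₀`; over each root exactly one point
maps to `P₀`, its negative going to `-P₀`. -/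
theorem card_nsmul_eq_zero {n : ℕ} (hn : 0 < n) :
    Nat.card {P : W.toAffine.Point // n • P = 0} = n ^ 2 := by
  obtain ⟨A, B, hAB⟩ := W.exists_isMulXDegree hn
  obtain ⟨x₀, hx₀⟩ := (hAB.finite_not_separable.union W.finite_negY_eq).exists_notMem
  simp only [Set.mem_union, Set.mem_ofPred_eq, not_or, not_not, not_exists, not_and] at hx₀
  obtain ⟨hsep, hneg⟩ := hx₀
  obtain ⟨y₀, h₀⟩ := W.exists_nonsingular x₀
  have hP₀ : Point.some x₀ y₀ h₀ ≠ -.some x₀ y₀ h₀ := by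
    rw [neg_some, Ne, Point.some.injEq, not_and]
    exact fun _ => hneg y₀ h₀.1
  obtain ⟨hm, hd⟩ := hAB.natDegree_sub x₀
  have hroots : (A - C x₀ * B).roots.toFinset.card = n ^ 2 := by
    rw [Multiset.toFinset_card_of_nodup (nodup_roots hsep),
      splits_iff_card_roots.mp (IsAlgClosed.splits _), hd]
  obtain ⟨Q₀, hQ₀⟩ := exists_nsmul_eq hn (Point.some x₀ y₀ h₀)
  have e : {P : W.toAffine.Point // n • P = 0} ≃
      {Q : W.toAffine.Point // n • Q = .some x₀ y₀ h₀} :=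
    (Equiv.addRight Q₀).subtypeEquiv fun P => by
      simp [smul_add, hQ₀]
  have hex (r : (A - C x₀ * B).roots.toFinset) : ∃ Q : W.toAffine.Point,
      n • Q = .some x₀ y₀ h₀ ∧ ∃ y h, Q = .some r.1 y h := by
    have hr := r.2
    rw [Multiset.mem_toFinset, mem_roots hm.ne_zero, IsRoot.def] at hr
    obtain ⟨y, h⟩ := W.exists_nonsingular r.1
    rcases (hAB.isMulX.eval_eq_iff h h₀).mp hr with hQ | hQ
    · exact ⟨_, hQ, y, h, rfl⟩
    · exact ⟨-.some r.1 y h, by rw [smul_neg, hQ, neg_neg], _, _, neg_some h⟩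
  choose f hf y h hfy using hex
  rw [Nat.card_congr e, ← hroots, ← Nat.card_eq_finsetCard]
  refine (Nat.card_eq_of_bijective (fun r => (⟨f r, hf r⟩ :
    {Q : W.toAffine.Point // n • Q = .some x₀ y₀ h₀})) ⟨fun r s hrs => ?_, ?_⟩).symm
  · have := congrArg Subtype.val hrs
    simp only [hfy, Point.some.injEq] at this
    exact Subtype.ext this.1
  · rintro ⟨Q, hQ⟩
    match Q, hQ with
    | 0, hQ => exact absurd ((smul_zero n).symm.trans hQ).symm (some_ne_zero _)
    | .some x y' h', hQ =>
      have hx := (hAB.isMulX.eval_eq_iff h' h₀).mpr (.inl hQ)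
      have hxr : x ∈ (A - C x₀ * B).roots.toFinset := by
        rwa [Multiset.mem_toFinset, mem_roots hm.ne_zero, IsRoot.def]
      refine ⟨⟨x, hxr⟩, Subtype.ext ?_⟩
      rcases (X_eq_iff (h₁ := h ⟨x, hxr⟩) (h₂ := h')).mp rfl with heq | heq
      · exact (hfy _).trans heq
      · have := hf ⟨x, hxr⟩
        rw [hfy, heq, smul_neg, hQ] at this
        exact absurd this.symm hP₀

end Torsion

end WeierstrassCurve

/-! ### The function field and its valuation at infinity -/

namespace WeierstrassCurve

open WeierstrassCurve.Affine Polynomial WithZero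

open scoped nonZeroDivisors Polynomial.Bivariate

/-- A field `L` which behaves like the function field over `K` of an elliptic curve `E`, with
coordinate functions `x` and `y`, together with the valuation `v` at the point at infinity. -/
structure FunctionFieldModel {k : Type*} [Field k] (E : WeierstrassCurve k) (K L : Type*) [Field K]
    [Field L] [Algebra k L] [Algebra k K] [Algebra K L] where
  /-- The first coordinate function. -/
  x : L
  /-- The second coordinate function. -/
  y : L
  /-- The valuation at the point at infinity. -/
  v : Valuation L ℤᵐ⁰
  equation : (E.baseChange L).toAffine.Equation x y
  v_aeval {p : K[X]} (hp : p ≠ 0) : v (aeval x p) = exp (2 * p.natDegree : ℤ)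
  v_y : v y = exp 3
  exists_eq_div (f : L) :
    ∃ p q d : K[X], d ≠ 0 ∧ f = (aeval x p + aeval x q * y) / aeval x d
  exists_ringHom (φ : K →+* L) (hφ : φ.comp (algebraMap k K) = algebraMap k L) (x' y' : L)
    (h : (E.baseChange L).toAffine.Equation x' y') (hx' : x' ∉ φ.range) :
    ∃ ψ : L →+* L, ψ.comp (algebraMap K L) = φ ∧ ψ x = x' ∧ ψ y = y'

section CoordinateRing

variable {K : Type*} [Field K] (W : WeierstrassCurve K)

lemma degree_norm_eq (p q : K[X]) :
    (Algebra.norm K[X] (p • (1 : W.toAffine.CoordinateRing) +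
      q • CoordinateRing.mk W.toAffine Y)).degree = max (2 • p.degree) (2 • q.degree + 3) :=
  CoordinateRing.degree_norm_smul_basis p q

/-- This is the ultrametric inequality for the pole order at `O`: the degree of the norm of `p + qy`
is the maximum of `2 deg p` and `2 deg q + 3`. -/
lemma degree_norm_add_le (a b : W.toAffine.CoordinateRing) :
    (Algebra.norm K[X] (a + b)).degree ≤
      max (Algebra.norm K[X] a).degree (Algebra.norm K[X] b).degree := by
  obtain ⟨p, q, rfl⟩ := CoordinateRing.exists_smul_basis_eq a
  obtain ⟨p', q', rfl⟩ := CoordinateRing.exists_smul_basis_eq b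
  rw [show p • (1 : W.toAffine.CoordinateRing) + q • CoordinateRing.mk W.toAffine Y +
    (p' • 1 + q' • CoordinateRing.mk W.toAffine Y) =
      (p + p') • 1 + (q + q') • CoordinateRing.mk W.toAffine Y by module,
    degree_norm_eq, degree_norm_eq, degree_norm_eq]
  have hmono : Monotone fun d : WithBot ℕ => 2 • d := fun a b hab => nsmul_le_nsmul_right hab 2
  have hmono' : Monotone fun d : WithBot ℕ => 2 • d + 3 := fun a b hab =>
    add_le_add_left (hmono hab) 3
  have h1 := (hmono (degree_add_le p p')).trans_eq (hmono.map_max (a := p.degree) (b := p'.degree))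
  have h2 := (hmono' (degree_add_le q q')).trans_eq
    (hmono'.map_max (a := q.degree) (b := q'.degree))
  exact max_le (h1.trans (max_le_max (le_max_left _ _) (le_max_left _ _)))
    (h2.trans (max_le_max (le_max_right _ _) (le_max_right _ _)))

variable {W} in
lemma norm_ne_zero {a : W.toAffine.CoordinateRing} (ha : a ≠ 0) : Algebra.norm K[X] a ≠ 0 :=
  have := Module.Finite.of_basis (CoordinateRing.basis W.toAffine)
  Algebra.norm_ne_zero_iff.mpr ha

variable {W} in
-- The cofactor is the conjugate of `a` under `y ↦ -y - a₁x - a₃`.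
lemma exists_mul_eq_norm (a : W.toAffine.CoordinateRing) :
    ∃ b, a * b = algebraMap K[X] _ (Algebra.norm K[X] a) := by
  obtain ⟨p, q, rfl⟩ := CoordinateRing.exists_smul_basis_eq a
  refine ⟨CoordinateRing.mk W.toAffine
    (C p + C q * (-(Y : K[X][Y]) - C (C W.a₁ * X + C W.a₃))), ?_⟩
  refine Eq.trans ?_ (CoordinateRing.coe_norm_smul_basis p q).symm
  rw [map_mul, CoordinateRing.smul, CoordinateRing.smul, mul_one, map_add _ (C p) (C q * X),
    map_mul _ (C q) X]

open Classical in
/-- The pole order at infinity, as a valuation on the coordinate ring. -/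
noncomputable def infinityValuation : Valuation W.toAffine.CoordinateRing ℤᵐ⁰ where
  toFun a := if a = 0 then 0 else exp ((Algebra.norm K[X] a).natDegree : ℤ)
  map_zero' := by simp
  map_one' := by simp
  map_mul' a b := by
    by_cases ha : a = 0
    · simp [ha]
    by_cases hb : b = 0
    · simp [hb]
    rw [if_neg ha, if_neg hb, if_neg (mul_ne_zero ha hb), map_mul, natDegree_mul
      (norm_ne_zero ha) (norm_ne_zero hb), Nat.cast_add, exp_add]
  map_add_le_max' a b := by
    by_cases ha : a = 0
    · simp [ha]
    by_cases hb : b = 0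
    · simp [hb]
    by_cases hab : a + b = 0
    · simp [hab]
    rw [if_neg ha, if_neg hb, if_neg hab]
    have h := degree_norm_add_le W a b
    rw [degree_eq_natDegree (norm_ne_zero ha),
      degree_eq_natDegree (norm_ne_zero hb),
      degree_eq_natDegree (norm_ne_zero hab)] at h
    rw [le_max_iff] at h ⊢
    simpa only [exp_le_exp, Nat.cast_le, Nat.cast_withBot, WithBot.coe_le_coe] using h

lemma infinityValuation_apply {a : W.toAffine.CoordinateRing} (ha : a ≠ 0) :
    W.infinityValuation a = exp ((Algebra.norm K[X] a).natDegree : ℤ) :=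
  by
  classical exact if_neg ha

lemma nonZeroDivisors_le_supp_infinityValuation :
    W.toAffine.CoordinateRing⁰ ≤ W.infinityValuation.supp.primeCompl := by
  intro a ha
  rw [Ideal.mem_primeCompl_iff, Valuation.mem_supp_iff,
    infinityValuation_apply W (nonZeroDivisors.ne_zero ha)]
  exact exp_ne_zero

lemma functionField_equation :
    letI x := algebraMap W.toAffine.CoordinateRing W.toAffine.FunctionField (algebraMap K[X] _ X)
    letI y := algebraMap W.toAffine.CoordinateRing W.toAffine.FunctionField (CoordinateRing.mk _ Y)
    letI a := algebraMap K W.toAffine.FunctionField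
    y ^ 2 + a W.a₁ * x * y + a W.a₃ * y = x ^ 3 + a W.a₂ * x ^ 2 + a W.a₄ * x + a W.a₆ := by
  have h : CoordinateRing.mk W.toAffine (Y ^ 2 + C (C W.a₁ * X + C W.a₃) * Y -
    C (X ^ 3 + C W.a₂ * X ^ 2 + C W.a₄ * X + C W.a₆)) = 0 := AdjoinRoot.mk_self
  replace h := congrArg (algebraMap W.toAffine.CoordinateRing W.toAffine.FunctionField) h
  simp only [map_add, map_sub, map_mul, map_pow, map_zero] at h
  have hX : algebraMap K[X] W.toAffine.CoordinateRing X = CoordinateRing.mk W.toAffine (C X) := rfl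
  have ha (a : K) : algebraMap K W.toAffine.FunctionField a =
    algebraMap W.toAffine.CoordinateRing _ (CoordinateRing.mk _ (C (C a))) := rfl
  simp only [hX, ha]
  linear_combination h

end CoordinateRing

section FunctionField

variable {k K : Type*} [Field k] [Field K] [Algebra k K] (E : WeierstrassCurve k)

/-- The function field of `E` over `K`. -/
abbrev GeomFunctionField (K : Type*) [Field K] [Algebra k K] : Type _ :=
  (E.baseChange K).toAffine.FunctionField

lemma algebraMap_polynomial_eq_aeval (p : K[X]) :
    algebraMap (E.baseChange K).toAffine.CoordinateRing (E.GeomFunctionField K)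
      (algebraMap K[X] _ p) =
    aeval (algebraMap (E.baseChange K).toAffine.CoordinateRing (E.GeomFunctionField K)
      (algebraMap K[X] _ X)) p := by
  rw [aeval_algebraMap_apply, aeval_algebraMap_apply, aeval_X_left_apply]

/-- The function field of an elliptic curve. -/
noncomputable def functionFieldModel [IsAlgClosed K] :
    FunctionFieldModel E K (E.GeomFunctionField K) where
  x := algebraMap (E.baseChange K).toAffine.CoordinateRing _ (algebraMap K[X] _ X)
  y := algebraMap (E.baseChange K).toAffine.CoordinateRing _ (CoordinateRing.mk _ Y)
  v := (E.baseChange K).infinityValuation.extendToLocalization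
    (nonZeroDivisors_le_supp_infinityValuation _) _
  equation := by
    have h := (E.baseChange K).functionField_equation
    have ha (a : k) : algebraMap k (E.GeomFunctionField K) a =
        algebraMap K _ (algebraMap k K a) := IsScalarTower.algebraMap_apply k K _ a
    rw [equation_iff]
    simp only [WeierstrassCurve.baseChange, map_a₁, map_a₂, map_a₃, map_a₄, map_a₆, ha] at h ⊢
    exact h
  v_aeval {p} hp := by
    have hp' : algebraMap K[X] (E.baseChange K).toAffine.CoordinateRing p ≠ 0 :=
      (map_ne_zero_iff _ (FaithfulSMul.algebraMap_injective _ _)).mpr hp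
    rw [← algebraMap_polynomial_eq_aeval, Valuation.extendToLocalization_apply_map_apply,
      infinityValuation_apply _ hp', Algebra.norm_algebraMap_of_basis (CoordinateRing.basis _)]
    simp
  v_y := by
    have h := degree_norm_eq (E.baseChange K) 0 1
    rw [zero_smul, one_smul, zero_add] at h
    have h' : (Algebra.norm K[X] (CoordinateRing.mk (E.baseChange K).toAffine Y)).degree =
        (3 : ℕ) := by
      rw [h]; simp
    have hy : CoordinateRing.mk (E.baseChange K).toAffine Y ≠ 0 := by
      intro hy
      have := Module.Finite.of_basis (CoordinateRing.basis (E.baseChange K).toAffine)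
      rw [hy, Algebra.norm_zero] at h'
      simp at h'
    rw [Valuation.extendToLocalization_apply_map_apply, infinityValuation_apply _ hy,
      natDegree_eq_of_degree_eq_some h']
    rfl
  exists_eq_div f := by
    obtain ⟨a, b, hb, rfl⟩ := IsFractionRing.div_surjective
      (A := (E.baseChange K).toAffine.CoordinateRing) f
    -- Multiplying by the conjugate of `b` makes the denominator a polynomial in `x`.
    obtain ⟨b', hb'⟩ := exists_mul_eq_norm b
    have hb0 := nonZeroDivisors.ne_zero hb
    obtain ⟨p, q, hpq⟩ := CoordinateRing.exists_smul_basis_eq (a * b')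
    refine ⟨p, q, _, norm_ne_zero hb0, ?_⟩
    have hN : algebraMap K[X] (E.baseChange K).toAffine.CoordinateRing (Algebra.norm K[X] b) ≠ 0 :=
      (map_ne_zero_iff _ (FaithfulSMul.algebraMap_injective _ _)).mpr (norm_ne_zero hb0)
    rw [← algebraMap_polynomial_eq_aeval, ← algebraMap_polynomial_eq_aeval,
      ← algebraMap_polynomial_eq_aeval, ← map_mul, ← map_add, ← Algebra.smul_def,
      div_eq_div_iff ((map_ne_zero_iff _ (IsFractionRing.injective _ _)).mpr hb0)
        ((map_ne_zero_iff _ (IsFractionRing.injective _ _)).mpr hN), ← map_mul, ← map_mul,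
      ← mul_one (algebraMap K[X] _ p), ← Algebra.smul_def, hpq, ← hb']
    congr 1
    ring
  exists_ringHom φ hφ x' y' h hx' := by
    have h0 : ((E.baseChange K).toAffine.polynomial).eval₂ (eval₂RingHom φ x') y' = 0 := by
      have ha (a : k) : φ (algebraMap k K a) = algebraMap k (E.GeomFunctionField K) a :=
        RingHom.congr_fun hφ a
      rw [equation_iff] at h
      simp [Affine.polynomial, WeierstrassCurve.baseChange, ha, eval₂_pow] at h ⊢
      linear_combination h
    set g := AdjoinRoot.lift (eval₂RingHom φ x') y' h0
    -- If `g` kills a nonzero `a`, it kills the norm of `a`. Then `x'` is a root of a nonzero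
    -- polynomial over `φ(K)`, hence lies in `φ(K)` because `K` is algebraically closed.
    have hg : Function.Injective g := by
      rw [injective_iff_map_eq_zero]
      intro a ha
      by_contra ha0
      obtain ⟨b, hb⟩ := exists_mul_eq_norm a
      have hN : (Algebra.norm K[X] a).eval₂ φ x' = 0 := by
        have := congrArg g hb
        rw [map_mul, ha, zero_mul] at this
        rw [this]
        exact (AdjoinRoot.lift_of h0).symm
      exact hx' ((IsAlgClosed.splits _).mem_range_of_isRoot (norm_ne_zero ha0)
        (by rwa [IsRoot.def, eval_map]))
    refine ⟨IsFractionRing.lift hg, ?_, ?_, ?_⟩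
    · ext c
      have : algebraMap K (E.GeomFunctionField K) c =
        algebraMap (E.baseChange K).toAffine.CoordinateRing _ (AdjoinRoot.of _ (C c)) := rfl
      rw [RingHom.comp_apply, this, IsFractionRing.lift_algebraMap, AdjoinRoot.lift_of]
      simp
    · refine (IsFractionRing.lift_algebraMap hg _).trans ((AdjoinRoot.lift_of h0).trans ?_)
      simp
    · exact (IsFractionRing.lift_algebraMap hg _).trans (AdjoinRoot.lift_root h0)

end FunctionField

end WeierstrassCurve

/-! ### Translations acting on the function field -/

namespace WeierstrassCurve

open WeierstrassCurve.Affine Polynomial WithZero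

instance isElliptic_baseChange {R A : Type*} [CommRing R] [CommRing A] [Algebra R A]
    (W : WeierstrassCurve R) [W.IsElliptic] : (W.baseChange A).IsElliptic :=
  inferInstanceAs (W.map (algebraMap R A)).IsElliptic

namespace FunctionFieldModel

variable {k K L : Type*} [Field k] [Field K] [Field L] [Algebra k K] [Algebra k L] [Algebra K L]
  {E : WeierstrassCurve k} (M : FunctionFieldModel E K L)

lemma v_algebraMap {c : K} (hc : c ≠ 0) : M.v (algebraMap K L c) = 1 := by
  simpa using M.v_aeval (C_ne_zero.mpr hc)

lemma v_algebraMap_le (c : K) : M.v (algebraMap K L c) ≤ 1 := by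
  by_cases hc : c = 0
  · simp [hc]
  · exact (M.v_algebraMap hc).le

lemma v_x_sub (c : K) : M.v (M.x - algebraMap K L c) = exp 2 := by
  simpa using M.v_aeval (X_sub_C_ne_zero c)

lemma v_x : M.v M.x = exp 2 := by simpa using M.v_x_sub 0

lemma x_ne (c : K) : M.x ≠ algebraMap K L c := by
  intro h
  have := M.v_x_sub c
  rw [h, sub_self, map_zero] at this
  exact exp_ne_zero this.symm

lemma aeval_x_ne_zero {p : K[X]} (hp : p ≠ 0) : aeval M.x p ≠ 0 := by
  intro h
  have := M.v_aeval hp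
  rw [h, map_zero] at this
  exact exp_ne_zero this.symm

lemma ringHom_ext {ψ ψ' : L →+* L} (hK : ∀ c : K, ψ (algebraMap K L c) = ψ' (algebraMap K L c))
    (hx : ψ M.x = ψ' M.x) (hy : ψ M.y = ψ' M.y) : ψ = ψ' := by
  have hp (p : K[X]) : ψ (aeval M.x p) = ψ' (aeval M.x p) := by
    rw [aeval_def, hom_eval₂, hom_eval₂, hx]
    congr 1
    exact RingHom.ext hK
  ext f
  obtain ⟨p, q, d, -, rfl⟩ := M.exists_eq_div f
  simp only [map_div₀, map_add, map_mul, hp, hy]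

variable [E.IsElliptic]

/-- The generic point of `E`. -/
def genericPoint : (E.baseChange L).toAffine.Point :=
  .some M.x M.y (equation_iff_nonsingular.mp M.equation)

variable [DecidableEq K] [DecidableEq L] [IsScalarTower k K L]

/-- There is already a point over `K` above `c`, and the only other point above `c` is its negative.
-/
lemma mem_range_baseChange [IsAlgClosed K] {c : K} {y : L}
    (h : (E.baseChange L).toAffine.Nonsingular (algebraMap K L c) y) :
    Point.some _ y h ∈ (Point.baseChange (W' := E) K L).range := by
  obtain ⟨y₀, h₀⟩ := (E.baseChange K).exists_nonsingular c
  have hmap : Point.baseChange (W' := E) K L (.some c y₀ h₀) =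
    .some (algebraMap K L c) (algebraMap K L y₀) _ := Point.map_some _ h₀
  rcases (Point.X_eq_iff (h₁ := h)).mp rfl with heq | heq
  · exact ⟨_, hmap.trans heq.symm⟩
  · exact ⟨-.some c y₀ h₀, by rw [map_neg, hmap, heq]⟩

lemma genericPoint_notMem_range : M.genericPoint ∉ (Point.baseChange (W' := E) K L).range := by
  rintro ⟨P, hP⟩
  match P, hP with
  | 0, hP => exact Point.some_ne_zero _ hP.symm
  | .some c d h, hP => exact M.x_ne c (Point.some.inj hP).1.symm

/-- The generic point plus a constant point is not constant, so its `x`-coordinate lies outside `K`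
and the generic point can be sent to it. -/
lemma exists_translate [IsAlgClosed K] (S : (E.baseChange K).toAffine.Point) :
    ∃ τ : L →ₐ[K] L, Point.map (W' := E) τ M.genericPoint =
      M.genericPoint + Point.baseChange (W' := E) K L S := by
  have hS : M.genericPoint + Point.baseChange (W' := E) K L S ∉
      (Point.baseChange (W' := E) K L).range := fun h => M.genericPoint_notMem_range <| by
    simpa using sub_mem h (AddMonoidHom.mem_range.mpr ⟨S, rfl⟩)
  cases hP : M.genericPoint + Point.baseChange (W' := E) K L S with
  | zero => exact absurd (hP ▸ zero_mem _) hS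
  | some x' y' h =>
    have hx' : x' ∉ (algebraMap K L).range := by
      rintro ⟨c, rfl⟩
      exact hS (hP ▸ mem_range_baseChange h)
    obtain ⟨ψ, hψ, hψx, hψy⟩ := M.exists_ringHom (algebraMap K L)
      (IsScalarTower.algebraMap_eq k K L).symm x' y' h.1 hx'
    refine ⟨{ ψ with commutes' := RingHom.congr_fun hψ }, ?_⟩
    refine (Point.map_some _ _).trans ?_
    congr 1

variable [IsAlgClosed K]

/-- Translation by a point, as an endomorphism `f(X) ↦ f(X + S)` of the function field. -/
noncomputable def translate (S : (E.baseChange K).toAffine.Point) : L →ₐ[K] L :=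
  (M.exists_translate S).choose

lemma map_translate (S : (E.baseChange K).toAffine.Point) :
    Point.map (W' := E) (M.translate S) M.genericPoint =
      M.genericPoint + Point.baseChange (W' := E) K L S :=
  (M.exists_translate S).choose_spec

omit [DecidableEq K] [IsAlgClosed K] in
-- As `x` and `y` generate `L` over `K`, identities between endomorphisms of `L` reduce to
-- identities in the group `E(L)`.
lemma algHom_ext {τ τ' : L →ₐ[K] L}
    (h : Point.map (W' := E) τ M.genericPoint = Point.map (W' := E) τ' M.genericPoint) :
    τ = τ' := by
  have h' := Point.some.inj h
  exact AlgHom.coe_ringHom_injective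
    (M.ringHom_ext (fun c => by simp) h'.1 h'.2)

lemma translate_zero : M.translate 0 = AlgHom.id K L :=
  M.algHom_ext (by rw [map_translate, map_zero, add_zero]; rfl)

lemma translate_add (S T : (E.baseChange K).toAffine.Point) :
    M.translate (S + T) = (M.translate S).comp (M.translate T) :=
  M.algHom_ext (by
    rw [map_translate, ← Point.map_map, map_translate,
      map_add (Point.map (W' := E) (M.translate S)),
      map_translate, map_add, add_assoc]
    congr 2
    exact (Point.map_baseChange (W' := E) (M.translate S) T).symm)

lemma translate_translate (S T : (E.baseChange K).toAffine.Point) (f : L) :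
    M.translate S (M.translate T f) = M.translate (S + T) f := by
  rw [translate_add]; rfl

end FunctionFieldModel

end WeierstrassCurve

/-! ### Valuations at points and divisors -/

namespace WeierstrassCurve

open WeierstrassCurve.Affine Polynomial WithZero

namespace FunctionFieldModel

variable {k K L : Type*} [Field k] [Field K] [Field L] [Algebra k K] [Algebra k L] [Algebra K L]
  {E : WeierstrassCurve k} (M : FunctionFieldModel E K L) [E.IsElliptic] [DecidableEq K]
  [DecidableEq L] [IsScalarTower k K L] [IsAlgClosed K]

/-- The valuation at the point `P`. -/
noncomputable def val (P : (E.baseChange K).toAffine.Point) : Valuation L ℤᵐ⁰ :=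
  M.v.comap (M.translate P : L →+* L)

lemma val_apply (P : (E.baseChange K).toAffine.Point) (f : L) :
    M.val P f = M.v (M.translate P f) :=
  rfl

lemma val_zero : M.val 0 = M.v := by
  ext f
  rw [val_apply, translate_zero]
  rfl

lemma val_translate (P S : (E.baseChange K).toAffine.Point) (f : L) :
    M.val P (M.translate S f) = M.val (P + S) f := by
  rw [val_apply, val_apply, translate_translate]

lemma val_algebraMap (P : (E.baseChange K).toAffine.Point) {c : K} (hc : c ≠ 0) :
    M.val P (algebraMap K L c) = 1 := by
  rw [val_apply, AlgHom.commutes, M.v_algebraMap hc]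

lemma val_algebraMap_le (P : (E.baseChange K).toAffine.Point) (c : K) :
    M.val P (algebraMap K L c) ≤ 1 := by
  rw [val_apply, AlgHom.commutes]
  exact M.v_algebraMap_le c

lemma translate_x {c d : K} (h : (E.baseChange K).toAffine.Nonsingular c d) :
    M.translate (.some c d h) M.x =
      ((M.y - algebraMap K L d) / (M.x - algebraMap K L c)) ^ 2 +
        algebraMap K L (E.baseChange K).a₁ *
          ((M.y - algebraMap K L d) / (M.x - algebraMap K L c)) -
        algebraMap K L (E.baseChange K).a₂ - M.x - algebraMap K L c := by
  have hx := M.x_ne c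
  obtain ⟨h', hbc⟩ : ∃ h', Point.baseChange (W' := E) K L (.some c d h) =
    .some (algebraMap K L c) (algebraMap K L d) h' := ⟨_, Point.map_some _ h⟩
  have hmap := (M.map_translate (.some c d h)).trans (congrArg (M.genericPoint + ·) hbc)
  have hτ := (Point.some.inj (hmap.trans (Point.add_of_X_ne hx))).1
  have ha (a : k) : algebraMap k L a = algebraMap K L (algebraMap k K a) :=
    IsScalarTower.algebraMap_apply k K L a
  rw [hτ, slope_of_X_ne hx, addX]
  simp only [WeierstrassCurve.baseChange, map_a₁, map_a₂, ha]

lemma translate_x_sub_mul {c d : K} (h : (E.baseChange K).toAffine.Nonsingular c d) :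
    (M.translate (.some c d h) M.x - algebraMap K L c) * (M.x - algebraMap K L c) ^ 2 =
      algebraMap K L ((E.baseChange K).toAffine.negY c d - d) * M.y +
      (algebraMap K L (3 * c ^ 2 + 2 * (E.baseChange K).a₂ * c + (E.baseChange K).a₄ -
        (E.baseChange K).a₁ * d) * M.x + algebraMap K L ((E.baseChange K).a₆ + d ^ 2 +
        (E.baseChange K).a₁ * c * d - (E.baseChange K).a₂ * c ^ 2 - 2 * c ^ 3)) := by
  have hx' := sub_ne_zero.mpr (M.x_ne c)
  rw [translate_x]
  have heq := (equation_iff ..).mp M.equation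
  have ha (a : k) : algebraMap k L a = algebraMap K L (algebraMap k K a) :=
    IsScalarTower.algebraMap_apply k K L a
  simp only [WeierstrassCurve.baseChange, map_a₁, map_a₂, map_a₃, map_a₄, map_a₆, ha, negY,
    map_add, map_sub, map_mul, map_neg, map_pow, map_ofNat] at heq ⊢
  field_simp
  linear_combination heq

/-- Translation moves the question to `O`, where `1`, `x`, `y` have pole orders 0, 2, 3. By
`translate_x_sub_mul` the translate of `x - c` is a combination of these divided by `(x - c)²`, of
pole order 4. The coefficient of `y` vanishes exactly at 2-torsion, where nonsingularity makes that
of `x` nonzero. -/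
lemma val_x_sub_self {c d : K} (h : (E.baseChange K).toAffine.Nonsingular c d) :
    M.val (.some c d h) (M.x - algebraMap K L c) =
      if d = (E.baseChange K).toAffine.negY c d then exp (-2) else exp (-1) := by
  have hmul := congrArg M.v (M.translate_x_sub_mul h)
  rw [map_mul, map_pow, M.v_x_sub] at hmul
  rw [val_apply, map_sub, AlgHom.commutes]
  set α := 3 * c ^ 2 + 2 * (E.baseChange K).a₂ * c + (E.baseChange K).a₄ - (E.baseChange K).a₁ * d
  set β := (E.baseChange K).a₆ + d ^ 2 + (E.baseChange K).a₁ * c * d -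
    (E.baseChange K).a₂ * c ^ 2 - 2 * c ^ 3
  have hsolve {u : ℤᵐ⁰} {m : ℤ} (hu : u * exp (2 : ℤ) ^ 2 = exp m) : u = exp (m - 4) := by
    rw [exp_sub, ← hu, ← exp_nsmul]
    simp
  have hβ := M.v_algebraMap_le β
  split_ifs with hd
  · rw [← hd, sub_self, map_zero, zero_mul, zero_add] at hmul
    have hα : α ≠ 0 := by
      intro hα
      rcases ((nonsingular_iff ..).mp h).2 with h1 | h1
      · exact h1 (by linear_combination -hα)
      · exact h1 hd
    have hαx : M.v (algebraMap K L α * M.x) = exp 2 := by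
      rw [map_mul, M.v_algebraMap hα, one_mul, v_x]
    rw [Valuation.map_add_eq_of_lt_left _ (by rw [hαx]; exact hβ.trans_lt (by decide)), hαx] at hmul
    exact hsolve hmul
  · have hψ : (E.baseChange K).toAffine.negY c d - d ≠ 0 := sub_ne_zero.mpr (Ne.symm hd)
    have hy : M.v (algebraMap K L ((E.baseChange K).toAffine.negY c d - d) * M.y) = exp 3 := by
      rw [map_mul, M.v_algebraMap hψ, one_mul, v_y]
    have hlt : M.v (algebraMap K L α * M.x + algebraMap K L β) < exp 3 := by
      refine (M.v.map_add _ _).trans_lt (max_lt ?_ (hβ.trans_lt (by decide)))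
      rw [map_mul, v_x]
      exact (mul_le_mul_left (M.v_algebraMap_le α) _).trans_lt (by rw [one_mul]; decide)
    rw [Valuation.map_add_eq_of_lt_left _ (by rwa [hy]), hy] at hmul
    exact hsolve hmul

/-- The divisor of a function: its order of vanishing at each point. -/
noncomputable def div (f : L) (P : (E.baseChange K).toAffine.Point) : ℤ :=
  -log (M.val P f)

variable {M} in
lemma val_eq_exp {f : L} (hf : f ≠ 0) (P : (E.baseChange K).toAffine.Point) :
    M.val P f = exp (-M.div f P) := by
  rw [div, neg_neg, exp_log ((Valuation.ne_zero_iff _).mpr hf)]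

lemma div_eq_of_val {f : L} {P : (E.baseChange K).toAffine.Point} {m : ℤ}
    (h : M.val P f = exp (-m)) : M.div f P = m := by
  rw [div, h, log_exp, neg_neg]

lemma div_mul {f g : L} (hf : f ≠ 0) (hg : g ≠ 0) : M.div (f * g) = M.div f + M.div g := by
  ext P
  rw [Pi.add_apply, div, map_mul, log_mul ((Valuation.ne_zero_iff _).mpr hf)
    ((Valuation.ne_zero_iff _).mpr hg), neg_add]
  rfl

lemma div_one : M.div 1 = 0 := by
  ext P
  simp [div]

lemma div_inv (f : L) : M.div f⁻¹ = -M.div f := by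
  ext P
  simp [div]

lemma div_prod {ι : Type*} (s : Finset ι) (f : ι → L) (hf : ∀ i ∈ s, f i ≠ 0) :
    M.div (∏ i ∈ s, f i) = ∑ i ∈ s, M.div (f i) := by
  induction s using Finset.cons_induction with
  | empty => simp [div_one]
  | cons i s hi ih =>
    rw [Finset.prod_cons, Finset.sum_cons, div_mul _ (hf i (Finset.mem_cons_self i s))
      (Finset.prod_ne_zero_iff.mpr fun j hj => hf j (Finset.mem_cons_of_mem hj)),
      ih fun j hj => hf j (Finset.mem_cons_of_mem hj)]

lemma div_translate (S P : (E.baseChange K).toAffine.Point) (f : L) :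
    M.div (M.translate S f) P = M.div f (P + S) := by
  rw [div, val_translate]; rfl

/-- A function with divisor `(A) + (-A) - 2(O)`. -/
noncomputable def vertical : (E.baseChange K).toAffine.Point → L
  | 0 => 1
  | .some c _ _ => M.x - algebraMap K L c

omit [E.IsElliptic] [DecidableEq K] [DecidableEq L] [IsScalarTower k K L] [IsAlgClosed K] in
lemma vertical_ne_zero (A : (E.baseChange K).toAffine.Point) : M.vertical A ≠ 0 := by
  match A with
  | 0 => exact one_ne_zero
  | .some c d h => exact sub_ne_zero.mpr (M.x_ne c)

lemma div_vertical (A : (E.baseChange K).toAffine.Point) :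
    M.div (M.vertical A) = Pi.single A 1 + Pi.single (-A) 1 - 2 • Pi.single 0 1 := by
  match A with
  | 0 =>
    change M.div (1 : L) = _
    rw [div_one, neg_zero]
    abel
  | .some c d h =>
    ext P
    simp only [Pi.add_apply, Pi.sub_apply, Pi.smul_apply]
    refine M.div_eq_of_val ?_
    match P with
    | 0 =>
      rw [val_zero, vertical, v_x_sub, Pi.single_eq_of_ne (Point.some_ne_zero _).symm,
        Pi.single_eq_of_ne (neg_ne_zero.mpr (Point.some_ne_zero _)).symm, Pi.single_eq_same]
      rfl
    | .some c' d' h' =>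
      rw [Pi.single_eq_of_ne (Point.some_ne_zero _) (i := 0)]
      by_cases hc : c' = c
      · subst hc
        have hP : d' = (E.baseChange K).toAffine.negY c' d' ↔
            Point.some c' d' h' = -.some c' d' h' := by
          rw [Point.neg_some, Point.some.injEq, eq_self, true_and]
        have hPA := (Point.X_eq_iff (h₁ := h') (h₂ := h)).mp rfl
        rw [vertical, M.val_x_sub_self h', if_congr hP rfl rfl]
        generalize Point.some c' d' h' = P at *
        generalize Point.some c' d h = A at *
        -- When `A = -A` the two simple zeros merge into a double one.
        rcases hPA with rfl | rfl
        · by_cases hP : P = -P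
          · rw [if_pos hP, ← hP]; simp
          · rw [if_neg hP, Pi.single_eq_of_ne hP]; simp
        · by_cases hA : -A = A
          · rw [if_pos (by rw [neg_neg, hA]), hA]; simp
          · rw [if_neg (by rwa [neg_neg]), Pi.single_eq_of_ne hA]; simp
      · have hne : Point.some c' d' h' ≠ .some c d h := fun heq => hc (Point.some.inj heq).1
        have hne' : Point.some c' d' h' ≠ -.some c d h := fun heq => hc (Point.some.inj heq).1
        rw [Pi.single_eq_of_ne hne, Pi.single_eq_of_ne hne', vertical]
        have hlt : M.val (.some c' d' h') (M.x - algebraMap K L c') < 1 := by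
          rw [M.val_x_sub_self h']
          split_ifs <;> decide
        rw [show M.x - algebraMap K L c = (M.x - algebraMap K L c') + algebraMap K L (c' - c) by
          rw [map_sub]; ring]
        have h1 := M.val_algebraMap (.some c' d' h') (sub_ne_zero.mpr hc)
        rw [Valuation.map_add_eq_of_lt_right _ (by rwa [h1]), h1]
        simp

end FunctionFieldModel

end WeierstrassCurve

/-! ### Functions with few poles are constant -/

namespace WeierstrassCurve

open WeierstrassCurve.Affine Polynomial WithZero

namespace FunctionFieldModel

variable {k K L : Type*} [Field k] [Field K] [Field L] [Algebra k K] [Algebra k L] [Algebra K L]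
  {E : WeierstrassCurve k} (M : FunctionFieldModel E K L)

lemma v_aeval_y {q : K[X]} (hq : q ≠ 0) :
    M.v (aeval M.x q * M.y) = exp (2 * q.natDegree + 3 : ℤ) := by
  rw [map_mul, M.v_aeval hq, M.v_y, exp_add]

/-- The two terms have pole orders of opposite parity, so they cannot cancel. -/
lemma v_aeval_add (p q : K[X]) : M.v (aeval M.x p + aeval M.x q * M.y) =
    max (M.v (aeval M.x p)) (M.v (aeval M.x q * M.y)) := by
  by_cases hp : p = 0
  · simp [hp]
  by_cases hq : q = 0
  · simp [hq]
  refine Valuation.map_add_of_distinct_val _ ?_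
  rw [M.v_aeval hp, M.v_aeval_y hq, Ne, exp_inj]
  omega

lemma exists_v_sub_lt {f : L} (hf : M.v f ≤ 1) : ∃ c : K, M.v (f - algebraMap K L c) < 1 := by
  obtain ⟨p, q, d, hd, rfl⟩ := M.exists_eq_div f
  have hvd := M.v_aeval hd
  have hd0 : 0 < M.v (aeval M.x d) := by rw [hvd]; exact exp_pos
  have key (p : K[X]) : M.v ((aeval M.x p + aeval M.x q * M.y) / aeval M.x d) =
      max (M.v (aeval M.x p)) (M.v (aeval M.x q * M.y)) / M.v (aeval M.x d) := by
    rw [map_div₀, v_aeval_add]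
  rw [key, div_le_one₀ hd0, max_le_iff] at hf
  -- The value at infinity is the ratio of the coefficients in degree `deg d`, as `deg p ≤ deg d`.
  -- The `y`-term has odd pole order and contributes nothing.
  refine ⟨p.coeff d.natDegree / d.leadingCoeff, ?_⟩
  set c := p.coeff d.natDegree / d.leadingCoeff
  have hsub : (aeval M.x p + aeval M.x q * M.y) / aeval M.x d - algebraMap K L c =
      (aeval M.x (p - C c * d) + aeval M.x q * M.y) / aeval M.x d := by
    have := M.aeval_x_ne_zero hd
    rw [map_sub, map_mul, aeval_C]
    field_simp
    ring
  rw [hsub, key, div_lt_one₀ hd0, max_lt_iff]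
  constructor
  · by_cases hr : p - C c * d = 0
    · rwa [hr, map_zero, map_zero]
    · rw [M.v_aeval hr, hvd, exp_lt_exp]
      have hle : (p - C c * d).natDegree ≤ d.natDegree := by
        refine (natDegree_sub_le_of_le ?_ (natDegree_C_mul_le c d)).trans (max_self _).le
        by_cases hp : p = 0
        · simp [hp]
        · have := hf.1
          rw [M.v_aeval hp, hvd, exp_le_exp] at this
          omega
      have hne : (p - C c * d).natDegree ≠ d.natDegree := by
        intro heq
        apply leadingCoeff_ne_zero.mpr hr
        rw [Polynomial.leadingCoeff, heq, coeff_sub, coeff_C_mul, coeff_natDegree,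
          div_mul_cancel₀ _ (leadingCoeff_ne_zero.mpr hd), sub_self]
      have := lt_of_le_of_ne hle hne
      omega
  · by_cases hq : q = 0
    · simpa [hq] using hd0
    · refine lt_of_le_of_ne hf.2 ?_
      rw [M.v_aeval_y hq, hvd, Ne, exp_inj]
      omega

variable [E.IsElliptic] [DecidableEq K] [DecidableEq L] [IsScalarTower k K L] [IsAlgClosed K]

lemma exists_val_sub_lt {P : (E.baseChange K).toAffine.Point} {f : L} (hf : M.val P f ≤ 1) :
    ∃ c : K, M.val P (f - algebraMap K L c) < 1 := by
  obtain ⟨c, hc⟩ := M.exists_v_sub_lt hf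
  exact ⟨c, by rwa [val_apply, map_sub, AlgHom.commutes]⟩

lemma val_x_sub_lt {c d : K} (h : (E.baseChange K).toAffine.Nonsingular c d) :
    M.val (.some c d h) (M.x - algebraMap K L c) < 1 := by
  rw [M.val_x_sub_self h]
  split_ifs <;> decide

lemma val_x_le {P : (E.baseChange K).toAffine.Point} (hP : P ≠ 0) : M.val P M.x ≤ 1 := by
  match P, hP with
  | 0, hP => exact absurd rfl hP
  | .some c d h, _ =>
    rw [← sub_add_cancel M.x (algebraMap K L c)]
    exact (Valuation.map_add _ _ _).trans
      (max_le (M.val_x_sub_lt h).le (M.val_algebraMap_le _ c))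

lemma val_aeval_le {P : (E.baseChange K).toAffine.Point} (hP : P ≠ 0) (p : K[X]) :
    M.val P (aeval M.x p) ≤ 1 := by
  induction p using Polynomial.induction_on' with
  | add p q hp hq =>
    rw [map_add]
    exact (Valuation.map_add _ _ _).trans (max_le hp hq)
  | monomial n c =>
    rw [aeval_monomial, map_mul, map_pow]
    exact mul_le_one' (M.val_algebraMap_le P c) (pow_le_one' (M.val_x_le hP) n)

/-- `y` is integral over `K[x]`, and `x` has no pole away from `O`. -/
lemma val_y_le {P : (E.baseChange K).toAffine.Point} (hP : P ≠ 0) : M.val P M.y ≤ 1 := by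
  set w := M.val P
  have heq := (equation_iff ..).mp M.equation
  have ha (a : k) : algebraMap k L a = algebraMap K L (algebraMap k K a) :=
    IsScalarTower.algebraMap_apply k K L a
  simp only [WeierstrassCurve.baseChange, map_a₁, map_a₂, map_a₃, map_a₄, map_a₆, ha] at heq
  have hsq : M.y * M.y = aeval M.x (X ^ 3 + C (algebraMap k K E.a₂) * X ^ 2 +
      C (algebraMap k K E.a₄) * X + C (algebraMap k K E.a₆)) -
      aeval M.x (C (algebraMap k K E.a₁) * X + C (algebraMap k K E.a₃)) * M.y := by
    simp only [map_add, map_mul, map_pow, aeval_X, aeval_C]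
    linear_combination heq
  by_contra! hlt
  have hle : w M.y * w M.y ≤ w M.y := by
    rw [← map_mul, hsq]
    refine (Valuation.map_sub _ _ _).trans (max_le ((M.val_aeval_le hP _).trans hlt.le) ?_)
    rw [map_mul]
    exact mul_le_of_le_one_left' (M.val_aeval_le hP _)
  exact absurd hle (not_le.mpr (lt_mul_of_one_lt_left (zero_lt_one.trans hlt) hlt))

/-- For `β ≠ 0` the quotient is, up to a constant, a slope `l = (y - e)/(x - c)`. Regularity forces
`(c, e)` onto the curve, and then `l` must have a pole at `-(c, e)`. -/
lemma eq_zero_of_linear_div_regular {α β c : K} (hreg : ∀ P : (E.baseChange K).toAffine.Point,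
    P ≠ 0 → M.val P ((algebraMap K L α + algebraMap K L β * M.y) / (M.x - algebraMap K L c)) ≤ 1) :
    α = 0 ∧ β = 0 := by
  have ht := sub_ne_zero.mpr (M.x_ne c)
  obtain ⟨d, h⟩ := (E.baseChange K).exists_nonsingular c
  by_cases hβ : β = 0
  · refine ⟨by_contra fun hα => ?_, hβ⟩
    have := hreg _ (Point.some_ne_zero h)
    rw [hβ, map_zero, zero_mul, add_zero, map_div₀, M.val_algebraMap _ hα,
      div_le_one₀ ((Valuation.pos_iff _).mpr ht)] at this
    exact not_le.mpr (M.val_x_sub_lt h) this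
  exfalso
  have hβ' : algebraMap K L β ≠ 0 := (_root_.map_ne_zero _).mpr hβ
  set e := -α / β
  set t := M.x - algebraMap K L c
  set l := (M.y - algebraMap K L e) / t
  have hl {P : (E.baseChange K).toAffine.Point} (hP : P ≠ 0) : l ∈ (M.val P).integer := by
    have h1 : l = algebraMap K L β⁻¹ *
        ((algebraMap K L α + algebraMap K L β * M.y) / t) := by
      simp only [l, e, map_div₀, map_neg, map_inv₀]
      field_simp
      ring
    rw [h1]
    exact mul_mem (M.val_algebraMap_le P _) (hreg P hP)
  have hc {P : (E.baseChange K).toAffine.Point} (a : K) : algebraMap K L a ∈ (M.val P).integer :=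
    M.val_algebraMap_le P a
  have hxc : M.x = algebraMap K L c + t := by simp [t]
  have hyc : M.y = algebraMap K L e + t * l := by simp only [l]; field_simp; ring
  have ha (a : k) : algebraMap k L a = algebraMap K L (algebraMap k K a) :=
    IsScalarTower.algebraMap_apply k K L a
  -- Substituting `x = c + t` and `y = e + t l` in the equation shows that its value at `(c, e)` is
  -- `t` times a function regular at `(c, d)`. This constant thus vanishes at `(c, d)`.
  have he : (E.baseChange K).toAffine.Equation c e := by
    rw [equation_iff']
    by_contra hne
    have hP := Point.some_ne_zero h
    have hone := M.val_algebraMap (.some c d h) hne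
    have heq := (equation_iff' ..).mp M.equation
    simp only [WeierstrassCurve.baseChange, map_a₁, map_a₂, map_a₃, map_a₄, map_a₆, ha] at heq hone
    set A := algebraMap K L
    have hfac : A (e ^ 2 + algebraMap k K E.a₁ * c * e + algebraMap k K E.a₃ * e -
        (c ^ 3 + algebraMap k K E.a₂ * c ^ 2 + algebraMap k K E.a₄ * c + algebraMap k K E.a₆)) =
        t * ((A c * A c + A c * A c + A c * A c) + (A c + A c + A c) * t + t * t +
          A (algebraMap k K E.a₂) * (A c + A c + t) + A (algebraMap k K E.a₄) -
          (A e * l + A e * l + t * (l * l) + A (algebraMap k K E.a₁) * (A e + A c * l + t * l) +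
          A (algebraMap k K E.a₃) * l)) := by
      rw [hxc, hyc] at heq
      simp only [map_add, map_sub, map_mul, map_pow]
      linear_combination heq
    have ht' : t ∈ (M.val (.some c d h)).integer := (M.val_x_sub_lt h).le
    rw [hfac, map_mul] at hone
    refine hone.not_lt (mul_lt_one_of_nonneg_of_lt_one_left zero_le (M.val_x_sub_lt h) ?_)
    rw [← Valuation.mem_integer_iff]
    have hl' := hl hP
    repeat' first
      | exact hl' | exact ht' | exact hc _ | apply add_mem | apply sub_mem | apply mul_mem
  have hQ := equation_iff_nonsingular.mp he
  have hQ0 : -Point.some c e hQ ≠ 0 := neg_ne_zero.mpr (Point.some_ne_zero hQ)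
  -- With `Q = (c, e)`, the function `x(X + Q)` has at `-Q` the pole of `x` at `O`, whereas the
  -- addition formula writes it as a polynomial in `l` and `x`, regular there.
  have hval := M.val_translate (-.some c e hQ) (.some c e hQ) M.x
  rw [neg_add_cancel, val_zero, v_x, translate_x] at hval
  have hmem : l ^ 2 + algebraMap K L (E.baseChange K).a₁ * l -
      algebraMap K L (E.baseChange K).a₂ - M.x - algebraMap K L c ∈
      (M.val (-.some c e hQ)).integer := by
    have hl' := hl hQ0
    have hx : M.x ∈ (M.val (-.some c e hQ)).integer := M.val_x_le hQ0
    exact sub_mem (sub_mem (sub_mem (add_mem (pow_mem hl' 2) (mul_mem (hc _) hl')) (hc _)) hx)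
      (hc _)
  rw [Valuation.mem_integer_iff, hval] at hmem
  exact absurd hmem (by decide)

/-- A function which is regular at all affine points is a polynomial in the coordinates. -/
lemma exists_eq_aeval_of_regular {f : L}
    (hf : ∀ P : (E.baseChange K).toAffine.Point, P ≠ 0 → M.val P f ≤ 1) :
    ∃ p q : K[X], f = aeval M.x p + aeval M.x q * M.y := by
  obtain ⟨p, q, d, hd, rfl⟩ := M.exists_eq_div f
  -- At a root `c` of the denominator, the remainders of `p` and `q` modulo `X - c` vanish by the
  -- linear case, so `X - c` cancels.
  induction hn : d.natDegree generalizing p q d with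
  | zero =>
    obtain ⟨c, rfl⟩ := natDegree_eq_zero.mp hn
    have hc : c ≠ 0 := fun h => hd (by rw [h, map_zero])
    refine ⟨C c⁻¹ * p, C c⁻¹ * q, ?_⟩
    have hc' : algebraMap K L c ≠ 0 := (_root_.map_ne_zero _).mpr hc
    simp only [map_mul, aeval_C, map_inv₀]
    field_simp
  | succ n ih =>
    have hdeg : d.degree ≠ 0 := by
      rw [degree_eq_natDegree hd, hn]
      exact_mod_cast n.succ_ne_zero
    obtain ⟨c, hc⟩ := IsAlgClosed.exists_root d hdeg
    obtain ⟨d₁, rfl⟩ := dvd_iff_isRoot.mpr hc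
    have hd₁ : d₁ ≠ 0 := right_ne_zero_of_mul hd
    obtain ⟨p₁, hp₁⟩ := X_sub_C_dvd_sub_C_eval (p := p) (a := c)
    obtain ⟨q₁, hq₁⟩ := X_sub_C_dvd_sub_C_eval (p := q) (a := c)
    rw [sub_eq_iff_eq_add] at hp₁ hq₁
    have ht := sub_ne_zero.mpr (M.x_ne c)
    have hd₁' := M.aeval_x_ne_zero hd₁
    have hlin : ∀ P : (E.baseChange K).toAffine.Point, P ≠ 0 →
        M.val P ((algebraMap K L (p.eval c) + algebraMap K L (q.eval c) * M.y) /
          (M.x - algebraMap K L c)) ≤ 1 := by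
      intro P hP
      have heq : (algebraMap K L (p.eval c) + algebraMap K L (q.eval c) * M.y) /
          (M.x - algebraMap K L c) =
          (aeval M.x p + aeval M.x q * M.y) / aeval M.x ((X - C c) * d₁) * aeval M.x d₁ -
            (aeval M.x p₁ + aeval M.x q₁ * M.y) := by
        rw [hp₁, hq₁]
        simp only [map_add, map_mul, map_sub, aeval_X, aeval_C, eval_add, eval_mul, eval_sub,
          eval_X, eval_C, sub_self, zero_mul, zero_add]
        field_simp
        ring
      rw [heq, ← Valuation.mem_integer_iff]
      have hp (p : K[X]) : aeval M.x p ∈ (M.val P).integer := M.val_aeval_le hP p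
      have hy : M.y ∈ (M.val P).integer := M.val_y_le hP
      have hf' : (aeval M.x p + aeval M.x q * M.y) / aeval M.x ((X - C c) * d₁) ∈
        (M.val P).integer := hf P hP
      exact sub_mem (mul_mem hf' (hp _)) (add_mem (hp _) (mul_mem (hp _) hy))
    obtain ⟨hp0, hq0⟩ := M.eq_zero_of_linear_div_regular hlin
    rw [hp0, map_zero, add_zero] at hp₁
    rw [hq0, map_zero, add_zero] at hq₁
    have heq : (aeval M.x p + aeval M.x q * M.y) / aeval M.x ((X - C c) * d₁) =
        (aeval M.x p₁ + aeval M.x q₁ * M.y) / aeval M.x d₁ := by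
      rw [hp₁, hq₁]
      simp only [map_mul, map_sub, aeval_X, aeval_C]
      field_simp
    rw [heq] at hf ⊢
    refine ih p₁ q₁ d₁ hd₁ hf ?_
    rw [natDegree_mul (X_sub_C_ne_zero c) hd₁, natDegree_X_sub_C] at hn
    omega

/-- A function with at most a simple pole at infinity and no other poles is constant. -/
lemma exists_eq_algebraMap {f : L}
    (hf : ∀ P : (E.baseChange K).toAffine.Point, P ≠ 0 → M.val P f ≤ 1) (hf₀ : M.v f ≤ exp 1) :
    ∃ c, f = algebraMap K L c := by
  obtain ⟨p, q, rfl⟩ := M.exists_eq_aeval_of_regular hf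
  rw [v_aeval_add, max_le_iff] at hf₀
  have hq : q = 0 := by
    by_contra hq
    have := hf₀.2
    rw [M.v_aeval_y hq, exp_le_exp] at this
    omega
  by_cases hp : p = 0
  · exact ⟨0, by simp [hp, hq]⟩
  · have := hf₀.1
    rw [M.v_aeval hp, exp_le_exp] at this
    obtain ⟨c, rfl⟩ := natDegree_eq_zero.mp (show p.natDegree = 0 by omega)
    exact ⟨c, by simp [hq]⟩

lemma exists_eq_algebraMap_of_div_nonneg {f : L} (hf : f ≠ 0) (h : ∀ P, 0 ≤ M.div f P) :
    ∃ c, f = algebraMap K L c := by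
  have hle (P : (E.baseChange K).toAffine.Point) : M.val P f ≤ 1 := by
    rw [val_eq_exp hf, ← exp_zero, exp_le_exp]
    exact neg_nonpos.mpr (h P)
  refine M.exists_eq_algebraMap (fun P _ => hle P) ?_
  rw [← val_zero]
  exact (hle 0).trans (by decide)

end FunctionFieldModel

end WeierstrassCurve

/-! ### Principal divisors and pullback under multiplication by `n` -/

namespace WeierstrassCurve

open WeierstrassCurve.Affine Polynomial WithZero

namespace FunctionFieldModel

variable {k K L : Type*} [Field k] [Field K] [Field L] [Algebra k K] [Algebra k L] [Algebra K L]
  {E : WeierstrassCurve k} (M : FunctionFieldModel E K L) [E.IsElliptic] [DecidableEq K]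
  [DecidableEq L] [IsScalarTower k K L] [IsAlgClosed K]

/-- The group of principal divisors. -/
def principal : AddSubgroup ((E.baseChange K).toAffine.Point → ℤ) where
  carrier := {D | ∃ f : L, f ≠ 0 ∧ M.div f = D}
  zero_mem' := ⟨1, one_ne_zero, M.div_one⟩
  add_mem' := by
    rintro _ _ ⟨f, hf, rfl⟩ ⟨g, hg, rfl⟩
    exact ⟨f * g, mul_ne_zero hf hg, M.div_mul hf hg⟩
  neg_mem' := by
    rintro _ ⟨f, hf, rfl⟩
    exact ⟨f⁻¹, inv_ne_zero hf, M.div_inv f⟩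

variable [CharZero K]

/-- Only vertical lines are needed: if `2S = P + Q`, the quotient of the verticals at `P - S` and
`S` has divisor `(P - S) + (S - P) - (S) - (-S)`, and shifting by `S` gives the claim. -/
lemma single_add_single_mem_principal (P Q : (E.baseChange K).toAffine.Point) :
    (Pi.single P 1 + Pi.single Q 1 - Pi.single (P + Q) 1 - Pi.single 0 1 :
      (E.baseChange K).toAffine.Point → ℤ) ∈ M.principal := by
  obtain ⟨S, hS⟩ := exists_nsmul_eq two_pos (P + Q)
  rw [two_nsmul] at hS
  refine ⟨M.translate (-S) (M.vertical (P - S) * (M.vertical S)⁻¹), ?_, ?_⟩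
  · rw [_root_.map_ne_zero]
    exact mul_ne_zero (M.vertical_ne_zero _) (inv_ne_zero (M.vertical_ne_zero _))
  · ext X
    rw [div_translate, div_mul _ (M.vertical_ne_zero _) (inv_ne_zero (M.vertical_ne_zero _)),
      div_inv, div_vertical, div_vertical]
    have hs (A B : (E.baseChange K).toAffine.Point) (h : B = A + S) :
        (Pi.single A 1 : (E.baseChange K).toAffine.Point → ℤ) (X + -S) =
        (Pi.single B 1 : (E.baseChange K).toAffine.Point → ℤ) X := by
      rw [Pi.single_apply, Pi.single_apply, h]
      exact if_congr (by rw [← sub_eq_add_neg, sub_eq_iff_eq_add]) rfl rfl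
    simp only [Pi.add_apply, Pi.sub_apply, Pi.neg_apply, Pi.smul_apply]
    rw [hs (P - S) P (by abel), hs (-(P - S)) Q (by rw [neg_sub, sub_add_eq_add_sub, hS]; abel),
      hs 0 S (by abel), hs S (P + Q) hS.symm, hs (-S) 0 (by abel)]
    simp only [nsmul_eq_mul, Nat.cast_ofNat]
    ring

/-- The homomorphism `P ↦ [(P) - (O)]`. -/
def toPic : (E.baseChange K).toAffine.Point →+
    ((E.baseChange K).toAffine.Point → ℤ) ⧸ M.principal where
  toFun P := QuotientAddGroup.mk (Pi.single P 1 - Pi.single 0 1)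
  map_zero' := by rw [sub_self]; rfl
  map_add' P Q := by
    rw [← QuotientAddGroup.mk_add, eq_comm, QuotientAddGroup.eq, ← neg_mem_iff]
    convert! M.single_add_single_mem_principal P Q using 1
    abel

end FunctionFieldModel

section

variable {k K : Type*} [Field k] [Field K] [Algebra k K] {E : WeierstrassCurve k} [E.IsElliptic]
  [DecidableEq K]

/-- The pullback of the divisor `(T) - (O)` under multiplication by `n`. -/
def pullbackDivisor (n : ℕ) (T P : (E.baseChange K).toAffine.Point) : ℤ :=
  (if n • P = T then 1 else 0) - (if n • P = 0 then 1 else 0)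

variable [IsAlgClosed K] [CharZero K]

lemma finite_torsion {W : WeierstrassCurve K} [W.IsElliptic] {n : ℕ} (hn : 0 < n) :
    {P : W.toAffine.Point | n • P = 0}.Finite :=
  Nat.finite_of_card_ne_zero (by
    rw [Set.coe_ofPred, card_nsmul_eq_zero hn]
    exact (pow_pos hn 2).ne')

/-- The finite set of `n`-torsion points. -/
noncomputable def torsionFinset (W : WeierstrassCurve K) [W.IsElliptic] {n : ℕ} (hn : 0 < n) :
    Finset W.toAffine.Point :=
  (finite_torsion hn).toFinset

lemma mem_torsionFinset {W : WeierstrassCurve K} [W.IsElliptic] {n : ℕ} {hn : 0 < n}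
    {P : W.toAffine.Point} : P ∈ W.torsionFinset hn ↔ n • P = 0 := by
  simp [torsionFinset]

lemma card_torsionFinset (W : WeierstrassCurve K) [W.IsElliptic] {n : ℕ} (hn : 0 < n) :
    (W.torsionFinset hn).card = n ^ 2 := by
  rw [← card_nsmul_eq_zero hn (W := W), ← Nat.card_eq_finsetCard]
  exact Nat.card_congr (Equiv.subtypeEquivRight fun P => mem_torsionFinset)

lemma pullbackDivisor_eq_sum {n : ℕ} (hn : 0 < n) (T' : (E.baseChange K).toAffine.Point) :
    pullbackDivisor n (n • T') = ∑ R ∈ (E.baseChange K).torsionFinset hn,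
      ((Pi.single (T' + R) 1 - Pi.single R 1 : (E.baseChange K).toAffine.Point → ℤ)) := by
  ext P
  have h (T : (E.baseChange K).toAffine.Point) : ∑ R ∈ (E.baseChange K).torsionFinset hn,
      (Pi.single (T + R) 1 : (E.baseChange K).toAffine.Point → ℤ) P =
        if n • P = n • T then 1 else 0 := by
    simp only [Pi.single_apply, ← sub_eq_iff_eq_add', Finset.sum_ite_eq, mem_torsionFinset,
      nsmul_sub, sub_eq_zero]
  have h0 := h 0
  simp only [zero_add, nsmul_zero] at h0
  rw [Finset.sum_apply]
  simp only [Pi.sub_apply]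
  rw [Finset.sum_sub_distrib, h, h0]
  rfl

variable {L : Type*} [Field L] [Algebra k L] [Algebra K L] [DecidableEq L] [IsScalarTower k K L]
  (M : FunctionFieldModel E K L)

/-- The pullback is a sum of `n²` divisors `(T' + R) - (R)`, each in the class of `(T') - (O)`. -/
lemma pullbackDivisor_sub_mem_principal {n : ℕ} (hn : 0 < n)
    (T' : (E.baseChange K).toAffine.Point) :
    pullbackDivisor n (n • T') - (Pi.single (n ^ 2 • T') 1 - Pi.single 0 1) ∈ M.principal := by
  have h : (QuotientAddGroup.mk (pullbackDivisor n (n • T')) :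
      ((E.baseChange K).toAffine.Point → ℤ) ⧸ M.principal) = M.toPic (n ^ 2 • T') := by
    have h' (R : (E.baseChange K).toAffine.Point) :
        (QuotientAddGroup.mk (Pi.single (T' + R) 1 - Pi.single R 1) :
          ((E.baseChange K).toAffine.Point → ℤ) ⧸ M.principal) = M.toPic T' := by
      have h1 : M.toPic T' = M.toPic (T' + R) - M.toPic R := by rw [map_add, add_sub_cancel_right]
      rw [h1]
      simp only [FunctionFieldModel.toPic, AddMonoidHom.coe_mk, ZeroHom.coe_mk]
      rw [← QuotientAddGroup.mk_sub, sub_sub_sub_cancel_right]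
    rw [pullbackDivisor_eq_sum hn, ← QuotientAddGroup.mk'_apply, map_sum]
    simp only [QuotientAddGroup.mk'_apply, h', Finset.sum_const, card_torsionFinset]
    rw [map_nsmul]
  rw [sub_eq_neg_add]
  exact QuotientAddGroup.eq.mp h.symm

lemma pullbackDivisor_mem_principal {n : ℕ} (hn : 0 < n) {T : (E.baseChange K).toAffine.Point}
    (hT : n • T = 0) : pullbackDivisor n T ∈ M.principal := by
  obtain ⟨T', rfl⟩ := exists_nsmul_eq hn T
  have := pullbackDivisor_sub_mem_principal M hn T'
  rwa [pow_two, mul_nsmul, hT, sub_self, sub_zero] at this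

end

end WeierstrassCurve

/-! ### The Weil pairing -/

namespace WeierstrassCurve

open WeierstrassCurve.Affine Polynomial WithZero

namespace FunctionFieldModel

variable {k K L : Type*} [Field k] [Field K] [Field L] [Algebra k K] [Algebra k L] [Algebra K L]
  {E : WeierstrassCurve k} (M : FunctionFieldModel E K L) [E.IsElliptic] [DecidableEq K]
  [DecidableEq L] [IsScalarTower k K L] [IsAlgClosed K] [CharZero K]

omit [CharZero K] in
lemma div_ne_zero_mul_inv {f g : L} (hf : f ≠ 0) (hg : g ≠ 0) :
    M.div (f * g⁻¹) = M.div f - M.div g := by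
  rw [div_mul _ hf (inv_ne_zero hg), div_inv, sub_eq_add_neg]


omit [CharZero K] in
lemma exists_eq_mul_of_div_eq {f g : L} (hf : f ≠ 0) (hg : g ≠ 0) (h : M.div f = M.div g) :
    ∃ c, f = algebraMap K L c * g := by
  obtain ⟨c, hc⟩ := M.exists_eq_algebraMap_of_div_nonneg (mul_ne_zero hf (inv_ne_zero hg))
    fun P => by rw [div_ne_zero_mul_inv _ hf hg, h, sub_self]; rfl
  exact ⟨c, by rw [← hc, mul_assoc, inv_mul_cancel₀ hg, mul_one]⟩

omit [E.IsElliptic] [IsAlgClosed K] [CharZero K] in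
lemma pullbackDivisor_add_torsion {n : ℕ} {S : (E.baseChange K).toAffine.Point} (hS : n • S = 0)
    (T P : (E.baseChange K).toAffine.Point) :
    pullbackDivisor n T (P + S) = pullbackDivisor n T P := by
  rw [pullbackDivisor, nsmul_add, hS, add_zero]; rfl

/-- The divisor of `g` is invariant under translation by `S`. Functions with that divisor differ by
constants, so one `c` serves all `g`. -/
lemma exists_translate_eq_mul {n : ℕ} (hn : 0 < n) {S T : (E.baseChange K).toAffine.Point}
    (hS : n • S = 0) (hT : n • T = 0) : ∃ c : K, ∀ g : L, g ≠ 0 → M.div g = pullbackDivisor n T →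
      M.translate S g = algebraMap K L c * g := by
  obtain ⟨g₀, hg₀, hdiv₀⟩ := pullbackDivisor_mem_principal M hn hT
  obtain ⟨c, hc⟩ := M.exists_eq_mul_of_div_eq ((_root_.map_ne_zero (M.translate S)).mpr hg₀) hg₀ (by
    ext P
    rw [div_translate, hdiv₀, pullbackDivisor_add_torsion hS])
  refine ⟨c, fun g hg hdiv => ?_⟩
  obtain ⟨d, rfl⟩ := M.exists_eq_mul_of_div_eq hg hg₀ (hdiv.trans hdiv₀.symm)
  rw [map_mul, AlgHom.commutes, hc]
  ring

open Classical in
/-- The Weil pairing on `n`-torsion points. -/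
noncomputable def weilPairing (n : ℕ) (S T : (E.baseChange K).toAffine.Point) : K :=
  if h : ∃ c : K, ∀ g : L, g ≠ 0 → M.div g = pullbackDivisor n T →
    M.translate S g = algebraMap K L c * g then h.choose else 0

lemma translate_eq_weilPairing_mul {n : ℕ} (hn : 0 < n) {S T : (E.baseChange K).toAffine.Point}
    (hS : n • S = 0) (hT : n • T = 0) {g : L} (hg : g ≠ 0) (hdiv : M.div g = pullbackDivisor n T) :
    M.translate S g = algebraMap K L (M.weilPairing n S T) * g := by
  have h := M.exists_translate_eq_mul hn hS hT
  rw [weilPairing, dif_pos h]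
  exact h.choose_spec g hg hdiv

lemma weilPairing_eq {n : ℕ} (hn : 0 < n) {S T : (E.baseChange K).toAffine.Point}
    (hS : n • S = 0) (hT : n • T = 0) {g : L} (hg : g ≠ 0) (hdiv : M.div g = pullbackDivisor n T)
    {c : K} (hc : M.translate S g = algebraMap K L c * g) : M.weilPairing n S T = c := by
  rw [M.translate_eq_weilPairing_mul hn hS hT hg hdiv] at hc
  exact (algebraMap K L).injective (mul_right_cancel₀ hg hc)

lemma weilPairing_ne_zero {n : ℕ} (hn : 0 < n) {S T : (E.baseChange K).toAffine.Point}
    (hS : n • S = 0) (hT : n • T = 0) : M.weilPairing n S T ≠ 0 := by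
  obtain ⟨g, hg, hdiv⟩ := pullbackDivisor_mem_principal M hn hT
  intro h0
  have h := M.translate_eq_weilPairing_mul hn hS hT hg hdiv
  rw [h0, map_zero, zero_mul] at h
  exact (_root_.map_ne_zero (M.translate S)).mpr hg h

lemma weilPairing_add_left {n : ℕ} (hn : 0 < n) {S₁ S₂ T : (E.baseChange K).toAffine.Point}
    (hS₁ : n • S₁ = 0) (hS₂ : n • S₂ = 0) (hT : n • T = 0) :
    M.weilPairing n (S₁ + S₂) T = M.weilPairing n S₁ T * M.weilPairing n S₂ T := by
  obtain ⟨g, hg, hdiv⟩ := pullbackDivisor_mem_principal M hn hT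
  refine M.weilPairing_eq hn (by rw [nsmul_add, hS₁, hS₂, add_zero]) hT hg hdiv ?_
  rw [← translate_translate, M.translate_eq_weilPairing_mul hn hS₂ hT hg hdiv, map_mul,
    AlgHom.commutes, M.translate_eq_weilPairing_mul hn hS₁ hT hg hdiv, map_mul]
  ring

lemma weilPairing_add_right {n : ℕ} (hn : 0 < n) {S T₁ T₂ : (E.baseChange K).toAffine.Point}
    (hS : n • S = 0) (hT₁ : n • T₁ = 0) (hT₂ : n • T₂ = 0) :
    M.weilPairing n S (T₁ + T₂) = M.weilPairing n S T₁ * M.weilPairing n S T₂ := by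
  obtain ⟨g₁, hg₁, hdiv₁⟩ := pullbackDivisor_mem_principal M hn hT₁
  obtain ⟨g₂, hg₂, hdiv₂⟩ := pullbackDivisor_mem_principal M hn hT₂
  obtain ⟨T₁', hT₁'⟩ := exists_nsmul_eq hn T₁
  obtain ⟨T₂', hT₂'⟩ := exists_nsmul_eq hn T₂
  obtain ⟨h, hh, hdivh⟩ := M.single_add_single_mem_principal T₁' T₂'
  set s := (E.baseChange K).torsionFinset hn
  have hτ (R : (E.baseChange K).toAffine.Point) : M.translate R h ≠ 0 :=
    (_root_.map_ne_zero (M.translate R)).mpr hh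
  -- This product over `E[n]` is invariant under translation by `S`, and dividing `g₁g₂` by it
  -- corrects the divisor to the one attached to `T₁ + T₂`.
  set H := ∏ R ∈ s, M.translate R h
  have hH : H ≠ 0 := Finset.prod_ne_zero_iff.mpr fun R _ => hτ R
  have hτH : M.translate S H = H := by
    rw [map_prod]
    simp only [translate_translate]
    refine Finset.prod_equiv (Equiv.addLeft S) (fun R => ?_) (fun R _ => rfl)
    simp [s, mem_torsionFinset, hS]
  have hdivH : M.div H = pullbackDivisor n T₁ + pullbackDivisor n T₂ -
      pullbackDivisor n (T₁ + T₂) := by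
    have hsum (A P : (E.baseChange K).toAffine.Point) : ∑ R ∈ s,
        (Pi.single A 1 : (E.baseChange K).toAffine.Point → ℤ) (P + R) =
          if n • P = n • A then 1 else 0 := by
      simp only [Pi.single_apply, ← eq_sub_iff_add_eq', Finset.sum_ite_eq', s, mem_torsionFinset,
        nsmul_sub, sub_eq_zero, eq_comm (a := n • A)]
    ext P
    rw [div_prod _ _ _ fun R _ => hτ R, Finset.sum_apply]
    simp only [div_translate, hdivh, Pi.add_apply, Pi.sub_apply, Finset.sum_add_distrib,
      Finset.sum_sub_distrib, hsum, nsmul_add, hT₁', hT₂', smul_zero, pullbackDivisor]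
    ring
  refine M.weilPairing_eq hn hS (by rw [nsmul_add, hT₁, hT₂, add_zero])
    (mul_ne_zero (mul_ne_zero hg₁ hg₂) (inv_ne_zero hH)) ?_ ?_
  · rw [div_ne_zero_mul_inv _ (mul_ne_zero hg₁ hg₂) hH, div_mul _ hg₁ hg₂, hdivH, hdiv₁, hdiv₂]
    abel
  · rw [map_mul, map_mul, map_inv₀, hτH, M.translate_eq_weilPairing_mul hn hS hT₁ hg₁ hdiv₁,
      M.translate_eq_weilPairing_mul hn hS hT₂ hg₂ hdiv₂, map_mul]
    ring

lemma weilPairing_self {n : ℕ} (hn : 0 < n) {T : (E.baseChange K).toAffine.Point}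
    (hT : n • T = 0) : M.weilPairing n T T = 1 := by
  obtain ⟨g, hg, hdiv⟩ := pullbackDivisor_mem_principal M hn hT
  obtain ⟨T', hT'⟩ := exists_nsmul_eq hn T
  have hτ (R : (E.baseChange K).toAffine.Point) : M.translate R g ≠ 0 :=
    (_root_.map_ne_zero (M.translate R)).mpr hg
  -- The divisor of this product telescopes to zero, so it is constant and fixed by translation by
  -- `T'`. Cancelling common factors leaves `g(X + nT') = g(X)`, where `nT' = T`.
  set G := ∏ i ∈ Finset.range n, M.translate (i • T') g
  have hG : G ≠ 0 := Finset.prod_ne_zero_iff.mpr fun i _ => hτ _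
  have hdivG : M.div G = M.div 1 := by
    ext P
    rw [div_prod _ _ _ fun i _ => hτ _, Finset.sum_apply, div_one]
    have hi (i : ℕ) : M.div (M.translate (i • T') g) P =
        (if n • P + i • T = T then 1 else 0) - (if n • P + (i + 1) • T = T then 1 else 0) := by
      rw [div_translate, hdiv, pullbackDivisor, nsmul_add, nsmul_left_comm, hT', succ_nsmul,
        ← add_assoc]
      simp only [add_eq_right]
    simp only [hi]
    rw [Finset.sum_range_sub' (fun i => if n • P + i • T = T then (1 : ℤ) else 0), hT, zero_nsmul,
      sub_self]
    rfl
  obtain ⟨c, hc⟩ := M.exists_eq_mul_of_div_eq hG one_ne_zero hdivG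
  have hτG : M.translate T' G = G := by
    rw [hc, map_mul, AlgHom.commutes, map_one]
  have hsucc : M.translate T' G = ∏ i ∈ Finset.range n, M.translate ((i + 1) • T') g := by
    rw [map_prod]
    simp only [translate_translate, succ_nsmul']
  rw [hsucc] at hτG
  have h1 := Finset.prod_range_succ (fun i => M.translate (i • T') g) n
  rw [Finset.prod_range_succ', hτG, hT'] at h1
  refine M.weilPairing_eq hn hT hT hg hdiv ?_
  have h2 := mul_left_cancel₀ hG h1
  rw [← h2, zero_nsmul, translate_zero]
  simp

omit [DecidableEq K] [CharZero K] in
lemma infinite_point (W : WeierstrassCurve K) [W.IsElliptic] : Infinite W.toAffine.Point := by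
  choose y h using W.exists_nonsingular
  exact Infinite.of_injective (fun x => Point.some x (y x) (h x)) fun a b hab =>
    (Point.some.inj hab).1

/-- If `T ≠ O` pairs trivially, `g` is invariant under `E[n]`. Subtracting its value at a suitable
`Q` gives `f` vanishing on `Q + E[n]`, with simple poles at `E[n]` only. Comparing with the pullback
of `(nQ) - (O)` gives a nonzero function with divisor at least `(n²Q) - (O)`; it must be constant,
yet it vanishes at `n²Q ≠ O`. -/
lemma eq_zero_of_weilPairing_eq_one {n : ℕ} (hn : 0 < n) {T : (E.baseChange K).toAffine.Point}
    (hT : n • T = 0) (h : ∀ S, n • S = 0 → M.weilPairing n S T = 1) : T = 0 := by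
  by_contra hT0
  obtain ⟨g, hg, hdiv⟩ := pullbackDivisor_mem_principal M hn hT
  have hτ {S : (E.baseChange K).toAffine.Point} (hS : n • S = 0) : M.translate S g = g := by
    rw [M.translate_eq_weilPairing_mul hn hS hT hg hdiv, h S hS, map_one, one_mul]
  have := infinite_point (E.baseChange K)
  obtain ⟨Q, hQ⟩ := (finite_torsion (W := E.baseChange K) (pow_pos hn 2)).exists_notMem
  rw [Set.mem_ofPred_eq] at hQ
  have hnQ : n • Q ≠ 0 := fun h0 => hQ (by rw [pow_two, mul_nsmul, h0, smul_zero])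
  have hreg {P : (E.baseChange K).toAffine.Point} (hP : n • P ≠ 0) : M.val P g ≤ 1 := by
    rw [val_eq_exp hg, hdiv, pullbackDivisor, if_neg hP, sub_zero, ← exp_zero, exp_le_exp]
    split_ifs <;> simp
  obtain ⟨c, hc⟩ := M.exists_val_sub_lt (hreg hnQ)
  set f := g - algebraMap K L c
  have hval {P : (E.baseChange K).toAffine.Point} (hP : n • P = 0) : M.val P f = exp 1 := by
    have hgP : M.val P g = exp 1 := by
      rw [val_eq_exp hg, hdiv, pullbackDivisor, if_neg (by rw [hP]; exact Ne.symm hT0), if_pos hP]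
      rfl
    rw [Valuation.map_sub_eq_of_lt_left _ (by
      rw [hgP]; exact (M.val_algebraMap_le P c).trans_lt (by decide)), hgP]
  have hf : f ≠ 0 := by
    intro hf
    have := hval (smul_zero n)
    rw [hf, map_zero] at this
    exact exp_ne_zero this.symm
  have hvalQ {P : (E.baseChange K).toAffine.Point} (hP : n • P = n • Q) : M.val P f < 1 := by
    have hR : n • (P - Q) = 0 := by rw [nsmul_sub, hP, sub_self]
    have : M.val P f = M.val Q f := by
      rw [← add_sub_cancel Q P, ← val_translate, map_sub, hτ hR, AlgHom.commutes]
    rwa [this]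
  have hdivf (P : (E.baseChange K).toAffine.Point) : pullbackDivisor n (n • Q) P ≤ M.div f P := by
    have hv := val_eq_exp (M := M) hf P
    rw [pullbackDivisor]
    by_cases h0 : n • P = 0
    · rw [hval h0, exp_inj] at hv
      rw [if_neg (by rw [h0]; exact hnQ.symm), if_pos h0]
      omega
    · rw [if_neg h0]
      split_ifs with hPQ
      · have := hvalQ hPQ
        rw [hv, ← exp_zero, exp_lt_exp] at this
        omega
      · have : M.val P f ≤ 1 := (Valuation.map_sub _ _ _).trans
          (max_le (hreg h0) (M.val_algebraMap_le P c))
        rw [hv, ← exp_zero, exp_le_exp] at this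
        omega
  obtain ⟨u, hu, hdivu⟩ := pullbackDivisor_sub_mem_principal M hn Q
  have hfu : f * u⁻¹ ≠ 0 := mul_ne_zero hf (inv_ne_zero hu)
  have hdivfu (P : (E.baseChange K).toAffine.Point) :
      (Pi.single (n ^ 2 • Q) 1 : (E.baseChange K).toAffine.Point → ℤ) P -
        (Pi.single 0 1 : (E.baseChange K).toAffine.Point → ℤ) P ≤ M.div (f * u⁻¹) P := by
    rw [div_ne_zero_mul_inv _ hf hu, hdivu]
    have := hdivf P
    simp only [Pi.sub_apply]
    omega
  obtain ⟨e, he⟩ := M.exists_eq_algebraMap (f := f * u⁻¹) (fun P hP => by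
      have h1 := hdivfu P
      rw [Pi.single_eq_of_ne hP, sub_zero, Pi.single_apply] at h1
      rw [val_eq_exp hfu, ← exp_zero, exp_le_exp]
      split_ifs at h1 <;> omega) (by
      have h1 := hdivfu 0
      rw [Pi.single_eq_of_ne (Ne.symm hQ), Pi.single_eq_same] at h1
      rw [← val_zero, val_eq_exp hfu, exp_le_exp]
      omega)
  have he0 : e ≠ 0 := by
    rintro rfl
    exact hfu (by rw [he, map_zero])
  have h1 := hdivfu (n ^ 2 • Q)
  rw [Pi.single_eq_same, Pi.single_eq_of_ne hQ, he, div, val_algebraMap _ _ he0] at h1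
  simp at h1

end FunctionFieldModel

end WeierstrassCurve

/-! ### Galois equivariance of the Weil pairing -/

namespace WeierstrassCurve

open WeierstrassCurve.Affine Polynomial WithZero

namespace FunctionFieldModel

variable {k K L : Type*} [Field k] [Field K] [Field L] [Algebra k K] [Algebra k L] [Algebra K L]
  {E : WeierstrassCurve k} (M : FunctionFieldModel E K L)

/-- Acting on coefficients preserves degrees in `K[X]`, hence pole orders at `O`. -/
lemma v_conj {σ : K →+* K} {φ : L →+* L} (hφ : φ.comp (algebraMap K L) = (algebraMap K L).comp σ)
    (hx : φ M.x = M.x) (hy : φ M.y = M.y) (f : L) : M.v (φ f) = M.v f := by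
  have hp (p : K[X]) : φ (aeval M.x p) = aeval M.x (p.map σ) := by
    rw [aeval_def, hom_eval₂, hφ, hx, aeval_def, eval₂_map]
  have hv (p : K[X]) : M.v (aeval M.x (p.map σ)) = M.v (aeval M.x p) := by
    by_cases h0 : p = 0
    · simp [h0]
    · rw [M.v_aeval h0, M.v_aeval ((Polynomial.map_ne_zero_iff σ.injective).mpr h0), natDegree_map]
  obtain ⟨p, q, d, -, rfl⟩ := M.exists_eq_div f
  rw [map_div₀, map_add, map_mul, hp, hp, hp, hy, map_div₀, map_div₀, v_aeval_add, v_aeval_add,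
    map_mul, map_mul, hv, hv, hv]

variable [IsScalarTower k K L]

lemma exists_conj (σ : Gal(K/k)) : ∃ φ : L →ₐ[k] L,
    (φ : L →+* L).comp (algebraMap K L) = (algebraMap K L).comp (σ : K →+* K) ∧
      φ M.x = M.x ∧ φ M.y = M.y := by
  have hσ : ((algebraMap K L).comp (σ : K →+* K)).comp (algebraMap k K) = algebraMap k L := by
    ext c
    simp [IsScalarTower.algebraMap_apply k K L c]
  obtain ⟨φ, hφ, hx, hy⟩ := M.exists_ringHom _ hσ M.x M.y M.equation (by
    rintro ⟨c, hc⟩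
    exact M.x_ne (σ c) hc.symm)
  refine ⟨{ φ with commutes' := fun c => ?_ }, hφ, hx, hy⟩
  refine (congrArg φ (IsScalarTower.algebraMap_apply k K L c)).trans ?_
  exact (RingHom.congr_fun hφ _).trans (RingHom.congr_fun hσ c)

/-- The extension of an automorphism of the field of constants to the function field that fixes
the coordinate functions. -/
noncomputable def conj (σ : Gal(K/k)) : L →ₐ[k] L := (M.exists_conj σ).choose

lemma conj_comp (σ : Gal(K/k)) : (M.conj σ : L →+* L).comp (algebraMap K L) =
    (algebraMap K L).comp (σ : K →+* K) :=
  (M.exists_conj σ).choose_spec.1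

lemma conj_algebraMap (σ : Gal(K/k)) (c : K) :
    M.conj σ (algebraMap K L c) = algebraMap K L (σ c) :=
  RingHom.congr_fun (M.conj_comp σ) c

lemma conj_x (σ : Gal(K/k)) : M.conj σ M.x = M.x := (M.exists_conj σ).choose_spec.2.1

lemma conj_y (σ : Gal(K/k)) : M.conj σ M.y = M.y := (M.exists_conj σ).choose_spec.2.2

lemma v_conj_apply (σ : Gal(K/k)) (f : L) : M.v (M.conj σ f) = M.v f :=
  M.v_conj (M.conj_comp σ) (M.conj_x σ) (M.conj_y σ) f

variable [E.IsElliptic] [DecidableEq K] [DecidableEq L]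

omit [DecidableEq K] in
lemma map_conj_genericPoint (σ : Gal(K/k)) :
    Point.map (W' := E) (M.conj σ) M.genericPoint = M.genericPoint := by
  refine (Point.map_some _ _).trans ?_
  unfold genericPoint
  congr 1
  · exact M.conj_x σ
  · exact M.conj_y σ

omit [E.IsElliptic] in
lemma map_conj_baseChange (σ : Gal(K/k)) (S : (E.baseChange K).toAffine.Point) :
    Point.map (W' := E) (M.conj σ) (Point.baseChange (W' := E) K L S) =
      Point.baseChange (W' := E) K L (Point.map (W' := E) (σ : K →ₐ[k] K) S) := by
  cases S with
  | zero => rfl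
  | some x y h =>
    have key {x₁ y₁ x₂ y₂ : L} {h₁ : (E.baseChange L).toAffine.Nonsingular x₁ y₁}
        {h₂ : (E.baseChange L).toAffine.Nonsingular x₂ y₂} (hx : x₁ = x₂) (hy : y₁ = y₂) :
        Point.some x₁ y₁ h₁ = Point.some x₂ y₂ h₂ := by subst hx hy; rfl
    exact key (M.conj_algebraMap σ x) (M.conj_algebraMap σ y)

variable [IsAlgClosed K]

/-- Both sides send the generic point, which `conj σ` fixes, to its sum with `σ(S)`. -/
lemma conj_translate (σ : Gal(K/k)) (S : (E.baseChange K).toAffine.Point) (f : L) :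
    M.conj σ (M.translate S f) =
      M.translate (Point.map (W' := E) (σ : K →ₐ[k] K) S) (M.conj σ f) := by
  set S' := Point.map (W' := E) (σ : K →ₐ[k] K) S with hS'
  have h1 : Point.map (W' := E) (M.conj σ)
      (Point.map (W' := E) (M.translate S) M.genericPoint) =
      Point.map (W' := E) (M.translate S') (Point.map (W' := E) (M.conj σ) M.genericPoint) := by
    rw [map_translate, map_conj_genericPoint, map_translate,
      map_add (Point.map (W' := E) (M.conj σ)),
      map_conj_genericPoint, map_conj_baseChange]
  have h2 := Point.some.inj h1
  refine RingHom.congr_fun (M.ringHom_ext (ψ := (M.conj σ : L →+* L).comp (M.translate S : L →+* L))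
    (ψ' := (M.translate S' : L →+* L).comp (M.conj σ : L →+* L)) (fun c => ?_) h2.1 h2.2) f
  simp [conj_algebraMap]

lemma val_conj (σ : Gal(K/k)) (P : (E.baseChange K).toAffine.Point) (f : L) :
    M.val (Point.map (W' := E) (σ : K →ₐ[k] K) P) (M.conj σ f) = M.val P f := by
  rw [val_apply, ← conj_translate, v_conj_apply, val_apply]

omit [E.IsElliptic] [IsAlgClosed K] in
lemma point_map_injective (σ : Gal(K/k)) :
    Function.Injective (Point.map (W' := E) (σ : K →ₐ[k] K)) :=
  Point.map_injective _

omit [E.IsElliptic] [IsAlgClosed K] in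
lemma point_map_surjective (σ : Gal(K/k)) :
    Function.Surjective (Point.map (W' := E) (σ : K →ₐ[k] K)) := fun P => by
  refine ⟨Point.map (W' := E) (σ.symm : K →ₐ[k] K) P, ?_⟩
  cases P with
  | zero => rfl
  | some x y h => rw [Point.map_some, Point.map_some]; simp

variable [CharZero K]

omit [CharZero K] in
lemma div_conj (σ : Gal(K/k)) {n : ℕ} {T : (E.baseChange K).toAffine.Point} {g : L}
    (hdiv : M.div g = pullbackDivisor n T) :
    M.div (M.conj σ g) = pullbackDivisor n (Point.map (W' := E) (σ : K →ₐ[k] K) T) := by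
  ext P'
  obtain ⟨P, rfl⟩ := point_map_surjective σ P'
  have := congrFun hdiv P
  rw [div, val_conj, ← div, this, pullbackDivisor, pullbackDivisor, ← map_nsmul]
  simp only [(point_map_injective σ).eq_iff, map_eq_zero_iff _ (point_map_injective σ)]

/-- Apply `conj σ` to the relation defining the pairing; the conjugate of `g` has the divisor
attached to `σ(T)`. -/
lemma weilPairing_map (σ : Gal(K/k)) {n : ℕ} (hn : 0 < n) {S T : (E.baseChange K).toAffine.Point}
    (hS : n • S = 0) (hT : n • T = 0) :
    M.weilPairing n (Point.map (W' := E) (σ : K →ₐ[k] K) S)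
      (Point.map (W' := E) (σ : K →ₐ[k] K) T) = σ (M.weilPairing n S T) := by
  obtain ⟨g, hg, hdiv⟩ := pullbackDivisor_mem_principal M hn hT
  refine M.weilPairing_eq hn (by rw [← map_nsmul, hS, map_zero])
    (by rw [← map_nsmul, hT, map_zero]) ((_root_.map_ne_zero (M.conj σ)).mpr hg)
    (M.div_conj σ hdiv) ?_
  rw [← conj_translate, M.translate_eq_weilPairing_mul hn hS hT hg hdiv, map_mul, conj_algebraMap]

end FunctionFieldModel

end WeierstrassCurve

/-! ### Freeness of the torsion from divisibility and counting -/

section TorsionGenerators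

variable {A : Type*} [AddCommGroup A]

lemma exists_generators_torsion_prime {p : ℕ} (hp : p.Prime)
    (hcard : Nat.card {P : A // p • P = 0} = p ^ 2) :
    ∃ P Q : A, p • P = 0 ∧ p • Q = 0 ∧ ∀ R : A, p • R = 0 → ∃ a b : ℤ, R = a • P + b • Q := by
  have : Fact p.Prime := ⟨hp⟩
  let V := AddSubgroup.torsionBy A (p : ℤ)
  let _ : Module (ZMod p) V := AddSubgroup.torsionBy.zmodModule
  have hmem (R : A) : R ∈ V ↔ p • R = 0 := AddSubgroup.torsionBy.nsmul_iff
  have hV : Nat.card V = p ^ 2 :=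
    (Nat.card_congr (Equiv.subtypeEquivRight hmem)).trans hcard
  have : Finite V := Nat.finite_of_card_ne_zero (by rw [hV]; exact pow_ne_zero _ hp.ne_zero)
  have hrank : Module.finrank (ZMod p) V = 2 := by
    have := Module.natCard_eq_pow_finrank (K := ZMod p) (V := V)
    rw [hV, Nat.card_zmod] at this
    exact (Nat.pow_right_injective hp.two_le this).symm
  let b := Module.finBasisOfFinrankEq (ZMod p) V hrank
  refine ⟨b 0, b 1, (hmem _).mp (b 0).2, (hmem _).mp (b 1).2, fun R hR => ?_⟩
  have hsum := b.sum_repr ⟨R, (hmem R).mpr hR⟩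
  rw [Fin.sum_univ_two] at hsum
  obtain ⟨s, hs⟩ := ZMod.intCast_surjective (b.repr ⟨R, (hmem R).mpr hR⟩ 0)
  obtain ⟨t, ht⟩ := ZMod.intCast_surjective (b.repr ⟨R, (hmem R).mpr hR⟩ 1)
  rw [← hs, ← ht, Int.cast_smul_eq_zsmul, Int.cast_smul_eq_zsmul] at hsum
  exact ⟨s, t, (congrArg Subtype.val hsum).symm⟩

lemma exists_generators_torsion (hdiv : ∀ n : ℕ, 0 < n → ∀ P : A, ∃ Q : A, n • Q = P)
    (hcard : ∀ n : ℕ, 0 < n → Nat.card {P : A // n • P = 0} = n ^ 2) (n : ℕ) (hn : 0 < n) :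
    ∃ P Q : A, n • P = 0 ∧ n • Q = 0 ∧ ∀ R : A, n • R = 0 → ∃ a b : ℤ, R = a • P + b • Q := by
  induction n using induction_on_primes with
  | zero => exact absurd hn (lt_irrefl 0)
  | one => exact ⟨0, 0, by simp, by simp, fun R hR => ⟨0, 0, by simpa using hR⟩⟩
  | prime_mul p m hp ih =>
    have hm : 0 < m := Nat.pos_of_mul_pos_left hn
    obtain ⟨P, Q, hP, hQ, hPQ⟩ := ih hm
    by_cases hpm : p ∣ m
    · obtain ⟨P', rfl⟩ := hdiv p hp.pos P
      obtain ⟨Q', rfl⟩ := hdiv p hp.pos Q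
      refine ⟨P', Q', by rw [mul_comm, mul_nsmul', hP], by rw [mul_comm, mul_nsmul', hQ],
        fun R hR => ?_⟩
      obtain ⟨a, b, hab⟩ := hPQ (p • R) (by rw [← mul_nsmul', mul_comm, hR])
      -- The difference is `p`-torsion, hence `m`-torsion as `p ∣ m`, hence a combination of `pP'`
      -- and `pQ'`.
      obtain ⟨c, d, hcd⟩ := hPQ (R - a • P' - b • Q') (by
        obtain ⟨t, rfl⟩ := hpm
        have h0 : p • (R - a • P' - b • Q') = 0 := by
          rw [nsmul_sub, nsmul_sub, hab, smul_comm p a, smul_comm p b]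
          abel
        rw [mul_nsmul, h0, smul_zero])
      refine ⟨a + c * p, b + d * p, ?_⟩
      rw [sub_sub, sub_eq_iff_eq_add] at hcd
      rw [hcd]
      simp only [add_smul, mul_smul, natCast_zsmul]
      abel
    · obtain ⟨P', Q', hP', hQ', hPQ'⟩ := exists_generators_torsion_prime hp (hcard p hp.pos)
      obtain ⟨u, v, huv⟩ : IsCoprime (p : ℤ) (m : ℤ) :=
        Nat.isCoprime_iff_coprime.mpr ((Nat.Prime.coprime_iff_not_dvd hp).mpr hpm)
      -- For coprime `p` and `m`, the Bézout idempotents `up` and `vm` project onto the `m`- and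
      -- `p`-torsion, so sums of generators generate.
      refine ⟨P + P', Q + Q', ?_, ?_, fun R hR => ?_⟩
      · rw [nsmul_add, mul_nsmul', hP, mul_nsmul, hP']; simp
      · rw [nsmul_add, mul_nsmul', hQ, mul_nsmul, hQ']; simp
      obtain ⟨a, b, hab⟩ := hPQ (p • R) (by rw [← mul_nsmul, hR])
      obtain ⟨c, d, hcd⟩ := hPQ' (m • R) (by rw [← mul_nsmul', hR])
      have hR' : R = (u * p + v * m) • R := by rw [huv, one_smul]
      refine ⟨u * a * (u * p) + v * c * (v * m), u * b * (u * p) + v * d * (v * m), ?_⟩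
      rw [← natCast_zsmul] at hP hQ hP' hQ' hab hcd
      rw [hR', add_smul, mul_smul, hab, mul_smul, hcd]
      have h1 : (u * p : ℤ) = 1 - v * m := by linarith
      have e1 : (u * p : ℤ) • P = P := by rw [h1, sub_smul, mul_smul, hP]; simp
      have e2 : (u * p : ℤ) • Q = Q := by rw [h1, sub_smul, mul_smul, hQ]; simp
      have e3 : (v * m : ℤ) • P' = P' := by
        rw [← sub_eq_of_eq_add' huv.symm, sub_smul, mul_smul, hP']; simp
      have e4 : (v * m : ℤ) • Q' = Q' := by
        rw [← sub_eq_of_eq_add' huv.symm, sub_smul, mul_smul, hQ']; simp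
      have f1 : (u * p : ℤ) • P' = 0 := by rw [mul_smul, hP', smul_zero]
      have f2 : (u * p : ℤ) • Q' = 0 := by rw [mul_smul, hQ', smul_zero]
      have f3 : (v * m : ℤ) • P = 0 := by rw [mul_smul, hP, smul_zero]
      have f4 : (v * m : ℤ) • Q = 0 := by rw [mul_smul, hQ, smul_zero]
      simp only [add_smul, mul_smul (u * a), mul_smul (v * c), mul_smul (u * b), mul_smul (v * d),
        smul_add, e1, e2, e3, e4, f1, f2, f3, f4, smul_zero, zero_add, add_zero]
      simp only [mul_smul]
      abel

/-- Two generators give a surjection from `(ℤ/n)²` onto a group of the same order `n²`. -/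
lemma nonempty_basis_torsionBy (hdiv : ∀ n : ℕ, 0 < n → ∀ P : A, ∃ Q : A, n • Q = P)
    (hcard : ∀ n : ℕ, 0 < n → Nat.card {P : A // n • P = 0} = n ^ 2) {n : ℕ} (hn : 0 < n)
    [Module (ZMod n) (AddSubgroup.torsionBy A (n : ℤ))] :
    Nonempty (Module.Basis (Fin 2) (ZMod n) (AddSubgroup.torsionBy A (n : ℤ))) := by
  have : NeZero n := ⟨hn.ne'⟩
  obtain ⟨P, Q, hP, hQ, hPQ⟩ := exists_generators_torsion hdiv hcard n hn
  have hmem (R : A) : R ∈ AddSubgroup.torsionBy A (n : ℤ) ↔ n • R = 0 :=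
    AddSubgroup.torsionBy.nsmul_iff
  have hV : Nat.card (AddSubgroup.torsionBy A (n : ℤ)) = n ^ 2 :=
    (Nat.card_congr (Equiv.subtypeEquivRight hmem)).trans (hcard n hn)
  have : Finite (AddSubgroup.torsionBy A (n : ℤ)) :=
    Nat.finite_of_card_ne_zero (by rw [hV]; exact pow_ne_zero _ hn.ne')
  let f : (Fin 2 → ZMod n) →ₗ[ZMod n] AddSubgroup.torsionBy A (n : ℤ) :=
    Fintype.linearCombination (ZMod n) ![⟨P, (hmem P).mpr hP⟩, ⟨Q, (hmem Q).mpr hQ⟩]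
  have hf : Function.Surjective f := by
    rintro ⟨R, hR⟩
    obtain ⟨a, b, rfl⟩ := hPQ R ((hmem R).mp hR)
    refine ⟨![a, b], ?_⟩
    rw [Fintype.linearCombination_apply, Fin.sum_univ_two]
    simp only [Matrix.cons_val_zero, Matrix.cons_val_one, Int.cast_smul_eq_zsmul]
    rfl
  have hf' : Function.Bijective f :=
    hf.bijective_of_nat_card_le (by rw [hV]; simp)
  exact ⟨Module.Basis.ofEquivFun (LinearEquiv.ofBijective f hf').symm⟩

end TorsionGenerators

/-! ### The determinant as cyclotomic character -/

section Pairing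

variable {A M : Type*} [AddCommGroup A] [CommGroup M]

lemma alternating_pairing_apply (e : A →+ A →+ Additive M) (halt : ∀ P, e P P = 0) (P Q : A)
    (a b c d : ℤ) :
    e (a • P + b • Q) (c • P + d • Q) = (a * d - b * c) • e P Q := by
  have hswap : e Q P = -e P Q := by
    have := halt (P + Q)
    simp only [map_add, AddMonoidHom.add_apply, halt, zero_add, add_zero] at this
    exact eq_neg_of_add_eq_zero_left (by rw [add_comm]; rwa [add_comm] at this)
  simp only [map_add, map_zsmul, AddMonoidHom.add_apply, AddMonoidHom.coe_smul, Pi.smul_apply, halt,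
    hswap, smul_zero, zero_add, add_zero, smul_neg, sub_smul, mul_smul, smul_comm c b,
    smul_comm d a]
  abel

end Pairing

section WeilPairing

variable {F : Type*} [Field F] (E : WeierstrassCurve F) (n : ℕ)

open scoped Classical in
/-- The Weil pairing on the `n`-torsion of an elliptic curve. -/
lemma exists_weilPairing [CharZero F] [E.IsElliptic] {n : ℕ} (hn : 0 < n) :
    ∃ e : torsionPoints E n →+ torsionPoints E n →+ Additive (AlgebraicClosure F)ˣ,
      (∀ P, e P P = 0) ∧ (∀ P, (∀ Q, e Q P = 0) → P = 0) ∧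
      ∀ (σ : Gal(AlgebraicClosure F/F)) (P Q : torsionPoints E n),
        ((e (galoisTorsionHom E n σ P) (galoisTorsionHom E n σ Q)).toMul : AlgebraicClosure F) =
          σ ((e P Q).toMul : AlgebraicClosure F) := by
  have : CharZero (AlgebraicClosure F) := algebraRat.charZero _
  let M := WeierstrassCurve.functionFieldModel (K := AlgebraicClosure F) E
  have hmem (P : torsionPoints E n) : n • (P : GeomPoint E) = 0 :=
    AddSubgroup.torsionBy.nsmul_iff.mp P.2
  let u (P Q : torsionPoints E n) : (AlgebraicClosure F)ˣ :=
    Units.mk0 (M.weilPairing n (P : GeomPoint E) Q) (M.weilPairing_ne_zero hn (hmem P) (hmem Q))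
  refine ⟨AddMonoidHom.mk' (fun P => AddMonoidHom.mk' (fun Q => Additive.ofMul (u P Q))
    fun Q₁ Q₂ => ?_) fun P₁ P₂ => ?_, fun P => ?_, fun P hP => ?_, fun σ P Q => ?_⟩
  · rw [← ofMul_mul]
    exact congrArg Additive.ofMul
      (Units.ext (M.weilPairing_add_right hn (hmem _) (hmem _) (hmem _)))
  · ext Q : 1
    refine Eq.trans ?_ (ofMul_mul _ _)
    exact congrArg Additive.ofMul (Units.ext (M.weilPairing_add_left hn (hmem _) (hmem _) (hmem _)))
  · exact congrArg Additive.ofMul (Units.ext (M.weilPairing_self hn (hmem _)))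
  · refine Subtype.ext (M.eq_zero_of_weilPairing_eq_one hn (hmem _) fun S hS => ?_)
    have := hP ⟨S, AddSubgroup.torsionBy.nsmul_iff.mpr hS⟩
    exact congrArg Units.val (congrArg Additive.toMul this)
  · exact M.weilPairing_map σ hn (hmem P) (hmem Q)

lemma galoisTorsionHom_basis (b : Module.Basis (Fin 2) (ZMod n) (torsionPoints E n))
    (σ : Gal(AlgebraicClosure F/F)) (j : Fin 2) :
    galoisTorsionHom E n σ (b j) =
      modGaloisRep E n b σ 0 j • b 0 + modGaloisRep E n b σ 1 j • b 1 := by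
  conv_lhs => rw [← b.sum_repr (galoisTorsionHom E n σ (b j)), Fin.sum_univ_two]
  have h (i : Fin 2) : modGaloisRep E n b σ i j = b.repr (galoisTorsionHom E n σ (b j)) i :=
    LinearMap.toMatrixAlgEquiv_apply b _ i j
  rw [h, h]

/-- The determinant of the mod-`n` Galois representation is the mod-`n` cyclotomic character. -/
lemma exists_isPrimitiveRoot_galois_apply [CharZero F] [E.IsElliptic] {n : ℕ} (hn : 0 < n)
    (b : Module.Basis (Fin 2) (ZMod n) (torsionPoints E n)) :
    ∃ z : (AlgebraicClosure F)ˣ, IsPrimitiveRoot z n ∧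
      ∀ (σ : Gal(AlgebraicClosure F/F)) (m : ℤ),
        (m : ZMod n) = (modGaloisRep E n b σ : Matrix (Fin 2) (Fin 2) (ZMod n)).det →
          σ (z : AlgebraicClosure F) = ((z ^ m : (AlgebraicClosure F)ˣ) : AlgebraicClosure F) := by
  obtain ⟨e, halt, hnd, hσ⟩ := exists_weilPairing E hn
  have hsum (P : torsionPoints E n) : ∃ s t : ℤ, P = s • b 0 + t • b 1 := by
    obtain ⟨s, hs⟩ := ZMod.intCast_surjective (b.repr P 0)
    obtain ⟨t, ht⟩ := ZMod.intCast_surjective (b.repr P 1)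
    refine ⟨s, t, ?_⟩
    rw [← Int.cast_smul_eq_zsmul (ZMod n), ← Int.cast_smul_eq_zsmul (ZMod n), hs, ht,
      ← Fin.sum_univ_two (fun i => b.repr P i • b i), b.sum_repr]
  have hprim : IsPrimitiveRoot (e (b 0) (b 1)).toMul n := by
    -- If the `m`-th power of the pairing at the basis is trivial, `m • b 1` pairs trivially with
    -- everything, so nondegeneracy kills it.
    have hord (m : ℕ) (hm : (e (b 0) (b 1)).toMul ^ m = 1) : m • b 1 = 0 := by
      refine hnd _ fun Q => ?_
      obtain ⟨s, t, rfl⟩ := hsum Q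
      have := alternating_pairing_apply e halt (b 0) (b 1) s t 0 m
      rw [zero_smul, zero_add, natCast_zsmul] at this
      rw [this, mul_zero, sub_zero, mul_smul, natCast_zsmul]
      change s • Additive.ofMul ((e (b 0) (b 1)).toMul ^ m) = 0
      rw [hm, ofMul_one, smul_zero]
    refine ⟨?_, fun m hm => ?_⟩
    · change Additive.toMul (n • e (b 0) (b 1)) = 1
      rw [← map_nsmul, ← Nat.cast_smul_eq_nsmul (ZMod n), CharP.cast_eq_zero, zero_smul, map_zero]
      rfl
    · have := hord m hm
      rw [← Nat.cast_smul_eq_nsmul (ZMod n)] at this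
      have h := congrArg (fun P => b.repr P 1) this
      simp only [map_smul, Module.Basis.repr_self, Finsupp.smul_apply, Finsupp.single_eq_same,
        smul_eq_mul, mul_one, map_zero, Finsupp.coe_zero, Pi.zero_apply] at h
      exact (ZMod.natCast_eq_zero_iff m n).mp h
  refine ⟨_, hprim, fun σ m hm => ?_⟩
  rw [← hσ, galoisTorsionHom_basis, galoisTorsionHom_basis]
  set ρ := modGaloisRep E n b σ
  obtain ⟨a, ha⟩ := ZMod.intCast_surjective (ρ 0 0)
  obtain ⟨c, hc⟩ := ZMod.intCast_surjective (ρ 0 1)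
  obtain ⟨a', ha'⟩ := ZMod.intCast_surjective (ρ 1 0)
  obtain ⟨c', hc'⟩ := ZMod.intCast_surjective (ρ 1 1)
  rw [← ha, ← hc, ← ha', ← hc']
  simp only [Int.cast_smul_eq_zsmul]
  rw [alternating_pairing_apply e halt, toMul_zsmul]
  congr 1
  rw [Matrix.det_fin_two, ← ha, ← hc, ← ha', ← hc'] at hm
  have hdvd : (n : ℤ) ∣ (a * c' - a' * c) - m := by
    rw [← ZMod.intCast_zmod_eq_zero_iff_dvd]
    push_cast
    rw [hm]
    ring
  have h1 := (hprim.zpow_eq_one_iff_dvd _).mpr hdvd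
  rwa [zpow_sub, mul_inv_eq_one] at h1

end WeilPairing

/-! ### Galois theory of fixing subgroups -/

section Galois

variable {k K : Type*} [Field k] [Field K] [Algebra k K]

/-- The elements fixed by all powers of `σ` form a field, which contains the adjunction as soon as
it contains the generators. -/
lemma IntermediateField.mem_fixingSubgroup_adjoin {s : Set K} {σ : Gal(K/k)} :
    σ ∈ (IntermediateField.adjoin k s).fixingSubgroup ↔ ∀ x ∈ s, σ x = x := by
  rw [IntermediateField.mem_fixingSubgroup_iff]
  refine ⟨fun h x hx => h x (IntermediateField.subset_adjoin k s hx), fun h x hx => ?_⟩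
  have hle : IntermediateField.adjoin k s ≤ IntermediateField.fixedField (Subgroup.zpowers σ) := by
    rw [IntermediateField.adjoin_le_iff]
    intro y hy
    rw [SetLike.mem_coe, IntermediateField.mem_fixedField_iff]
    intro τ hτ
    have : Subgroup.zpowers σ ≤ MulAction.stabilizer Gal(K/k) y :=
      Subgroup.zpowers_le.mpr (h y hy)
    exact this hτ
  exact (IntermediateField.mem_fixedField_iff _ _).mp (hle hx) σ (Subgroup.mem_zpowers σ)

lemma IntermediateField.fixingSubgroup_injective_of_isGalois [IsGalois k K]
    {L L' : IntermediateField k K} (h : L.fixingSubgroup = L'.fixingSubgroup) : L = L' := by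
  rw [← InfiniteGalois.fixedField_fixingSubgroup L, h, InfiniteGalois.fixedField_fixingSubgroup]

/-- Restriction to `L` is surjective with kernel the fixing subgroup, so the condition is that
commutators restrict trivially. -/
lemma IntermediateField.isMulCommutative_gal_iff [Normal k K] (L : IntermediateField k K)
    [Normal k L] :
    IsMulCommutative Gal(L/k) ↔ ∀ σ τ : Gal(K/k), (τ * σ)⁻¹ * (σ * τ) ∈ L.fixingSubgroup := by
  rw [isMulCommutative_iff,
    (AlgEquiv.restrictNormalHom_surjective (F := k) (K₁ := L) K).forall₂]
  refine forall₂_congr fun σ τ => ?_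
  rw [← IntermediateField.restrictNormalHom_ker, MonoidHom.mem_ker, map_mul, map_inv, map_mul,
    map_mul, inv_mul_eq_one, eq_comm]

/-- Primitive roots are powers of one another; this replaces the root supplied by the Weil pairing
with the given `ζ`. -/
lemma IsPrimitiveRoot.map_eq_self_iff {z w : K} {n : ℕ} (hn : 0 < n) (hz : IsPrimitiveRoot z n)
    (hw : IsPrimitiveRoot w n) (σ : Gal(K/k)) : σ z = z ↔ σ w = w := by
  have : NeZero n := ⟨hn.ne'⟩
  have aux {z w : K} (hz : IsPrimitiveRoot z n) (hw : IsPrimitiveRoot w n) (h : σ z = z) :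
      σ w = w := by
    obtain ⟨i, -, rfl⟩ := hz.eq_pow_of_pow_eq_one hw.pow_eq_one
    rw [map_pow, h]
  exact ⟨aux hz hw, aux hw hz⟩

end Galois

/-! ### The division field, the kernels of `ρ` and `det ∘ ρ`, and the theorem -/

section DivisionField

variable {F : Type*} [Field F] (E : WeierstrassCurve F) (n : ℕ)

lemma galoisPointHom_some_eq_iff (σ : Gal(AlgebraicClosure F/F)) {x y : AlgebraicClosure F}
    (h : (E.baseChange (AlgebraicClosure F)).toAffine.Nonsingular x y) :
    galoisPointHom E σ (.some x y h) = .some x y h ↔ σ x = x ∧ σ y = y :=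
  iff_of_eq (WeierstrassCurve.Affine.Point.some.injEq _ _ _ _ _ _)

lemma mem_fixingSubgroup_divisionField {σ : Gal(AlgebraicClosure F/F)} :
    σ ∈ (divisionField E n).fixingSubgroup ↔
      ∀ P ∈ torsionPoints E n, galoisPointHom E σ P = P := by
  rw [divisionField, IntermediateField.mem_fixingSubgroup_adjoin]
  constructor
  · intro h P hP
    cases P with
    | zero => rfl
    | some x y hxy =>
      exact (galoisPointHom_some_eq_iff E σ hxy).mpr
        ⟨h x ⟨x, y, hxy, hP, .inl rfl⟩, h y ⟨x, y, hxy, hP, .inr rfl⟩⟩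
  · rintro h z ⟨x, y, hxy, hP, hz⟩
    have := (galoisPointHom_some_eq_iff E σ hxy).mp (h _ hP)
    rcases hz with rfl | rfl
    exacts [this.1, this.2]

/-- Galois automorphisms permute `E[n]`, hence the generating coordinates. -/
lemma normal_divisionField : Normal F (divisionField E n) := by
  rw [IntermediateField.normal_iff_forall_map_le']
  intro σ
  rw [divisionField, IntermediateField.adjoin_map]
  refine IntermediateField.adjoin.mono _ _ _ ?_
  rintro _ ⟨z, ⟨x, y, hxy, hP, hz⟩, rfl⟩
  have hmem := galoisPointHom_mem E n σ ⟨_, hP⟩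
  refine ⟨σ x, σ y, _, hmem, ?_⟩
  rcases hz with rfl | rfl
  exacts [.inl rfl, .inr rfl]

lemma modGaloisRep_eq_one_iff (b : Module.Basis (Fin 2) (ZMod n) (torsionPoints E n))
    {σ : Gal(AlgebraicClosure F/F)} :
    modGaloisRep E n b σ = 1 ↔ σ ∈ (divisionField E n).fixingSubgroup := by
  rw [mem_fixingSubgroup_divisionField, Units.ext_iff]
  change LinearMap.toMatrixAlgEquiv b (galoisTorsionHom E n σ) = 1 ↔ _
  rw [EmbeddingLike.map_eq_one_iff]
  constructor
  · intro h P hP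
    exact congrArg Subtype.val (LinearMap.congr_fun h ⟨P, hP⟩)
  · intro h
    ext P
    exact h P P.2

/-- `σ` raises a primitive root `z` to the power `m`, a lift of the determinant, and `z ^ m = z`
exactly when `m ≡ 1` modulo `n`. -/
lemma det_modGaloisRep_eq_one_iff [CharZero F] [E.IsElliptic] {n : ℕ} (hn : 0 < n)
    (b : Module.Basis (Fin 2) (ZMod n) (torsionPoints E n)) {ζ : AlgebraicClosure F}
    (hζ : IsPrimitiveRoot ζ n) {σ : Gal(AlgebraicClosure F/F)} :
    Matrix.GeneralLinearGroup.det (modGaloisRep E n b σ) = 1 ↔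
      σ ∈ (IntermediateField.adjoin F {ζ}).fixingSubgroup := by
  obtain ⟨z, hz, hσ⟩ := exists_isPrimitiveRoot_galois_apply E hn b
  rw [IntermediateField.mem_fixingSubgroup_adjoin,
    show (∀ x ∈ ({ζ} : Set _), σ x = x) ↔ σ ζ = ζ from forall_eq,
    hζ.map_eq_self_iff hn (hz.map_of_injective Units.val_injective (f := Units.coeHom _)),
    Units.ext_iff, Matrix.GeneralLinearGroup.val_det_apply, Units.val_one, Units.coeHom_apply]
  obtain ⟨m, hm⟩ := ZMod.intCast_surjective
    (modGaloisRep E n b σ : Matrix (Fin 2) (Fin 2) (ZMod n)).det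
  rw [← hm, hσ σ m hm, Units.val_inj]
  have h1 : z ^ m = z ↔ z ^ (m - 1) = 1 := by rw [zpow_sub_one, mul_inv_eq_one]
  rw [h1, hz.zpow_eq_one_iff_dvd, ← ZMod.intCast_zmod_eq_zero_iff_dvd]
  push_cast
  rw [sub_eq_zero]

end DivisionField

lemma Matrix.SpecialLinearGroup.mem_range_toGL_iff {m R : Type*} [Fintype m] [DecidableEq m]
    [CommRing R] {g : Matrix.GeneralLinearGroup m R} :
    g ∈ (Matrix.SpecialLinearGroup.toGL (n := m) (R := R)).range ↔
      Matrix.GeneralLinearGroup.det g = 1 := by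
  constructor
  · rintro ⟨s, rfl⟩
    exact Units.ext s.2
  · intro h
    exact ⟨⟨g, congrArg Units.val h⟩, Units.ext rfl⟩

open scoped Classical in
lemma nonempty_basis_torsionPoints {F : Type*} [Field F] [CharZero F] (E : WeierstrassCurve F)
    [E.IsElliptic] {n : ℕ} (hn : 0 < n) :
    Nonempty (Module.Basis (Fin 2) (ZMod n) (torsionPoints E n)) := by
  have : CharZero (AlgebraicClosure F) := algebraRat.charZero _
  exact nonempty_basis_torsionBy
    (fun _ hd P => (E.baseChange (AlgebraicClosure F)).exists_nsmul_eq hd P)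
    (fun _ hd => (E.baseChange (AlgebraicClosure F)).card_nsmul_eq_zero hd) hn

theorem proposition3p1 {F : Type*} [Field F] [Algebra ℚ F] [Algebra.IsAlgebraic ℚ F]
    (E : WeierstrassCurve F) [E.IsElliptic] (n : ℕ) (hn : 0 < n)
    (ζ : AlgebraicClosure F) (hζ : IsPrimitiveRoot ζ n) :
    Nonempty (Module.Basis (Fin 2) (ZMod n) (torsionPoints E n)) ∧
    ∀ (b : Module.Basis (Fin 2) (ZMod n) (torsionPoints E n))
      (G : Subgroup (Matrix.GeneralLinearGroup (Fin 2) (ZMod n))),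
      G = (modGaloisRep E n b).range →
      -- part (a)
      (IsMulCommutative G ↔ IsAbelianGalois F (divisionField E n)) ∧
      -- part (b)
      (G ⊓ (Matrix.SpecialLinearGroup.toGL (n := Fin 2) (R := ZMod n)).range = ⊥ ↔
        divisionField E n = IntermediateField.adjoin F {ζ}) ∧
      (divisionField E n = IntermediateField.adjoin F {ζ} →
        IsMulCommutative G ∧
        Function.Injective (Matrix.GeneralLinearGroup.det.comp G.subtype)) := by
  have : CharZero F := algebraRat.charZero F
  refine ⟨nonempty_basis_torsionPoints E hn, ?_⟩
  rintro b _ rfl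
  have := normal_divisionField E n
  have hdet {σ : Gal(AlgebraicClosure F/F)} := det_modGaloisRep_eq_one_iff E hn b hζ (σ := σ)
  have hone {σ : Gal(AlgebraicClosure F/F)} := modGaloisRep_eq_one_iff E n b (σ := σ)
  have hinj (h : divisionField E n = IntermediateField.adjoin F {ζ}) : Function.Injective
      (Matrix.GeneralLinearGroup.det.comp (modGaloisRep E n b).range.subtype) := by
    rw [injective_iff_map_eq_one]
    rintro ⟨_, σ, rfl⟩ hσ
    exact Subtype.ext (hone.mpr (h ▸ hdet.mp hσ))
  refine ⟨⟨fun hG => ?_, fun hG => ?_⟩, ⟨fun hG => ?_, fun h => ?_⟩, fun h => ⟨?_, hinj h⟩⟩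
  · have hcomm : IsMulCommutative Gal(divisionField E n/F) := by
      refine (IntermediateField.isMulCommutative_gal_iff _).mpr fun σ τ => hone.mp ?_
      have := isMulCommutative_iff.mp hG ⟨_, σ, rfl⟩ ⟨_, τ, rfl⟩
      rw [map_mul, map_inv, inv_mul_eq_one, map_mul, map_mul]
      exact (congrArg Subtype.val this).symm
    -- Normality is established above, and separability is automatic in characteristic zero.
    have : IsGalois F (divisionField E n) := { }
    exact { }
  · have hcomm := (IntermediateField.isMulCommutative_gal_iff (divisionField E n)).mp hG.2
    refine isMulCommutative_iff.mpr ?_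
    rintro ⟨_, σ, rfl⟩ ⟨_, τ, rfl⟩
    have := hone.mpr (hcomm σ τ)
    rw [map_mul, map_inv, inv_mul_eq_one, map_mul, map_mul] at this
    exact Subtype.ext this.symm
  · refine IntermediateField.fixingSubgroup_injective_of_isGalois ?_
    ext σ
    rw [← hone, ← hdet]
    -- The kernel of `ρ` always lies in that of `det ∘ ρ`; the trivial intersection with `SL₂` gives
    -- the reverse inclusion.
    refine ⟨fun h => by rw [h, map_one], fun h => ?_⟩
    have : modGaloisRep E n b σ ∈ (⊥ : Subgroup _) := hG ▸
      ⟨⟨σ, rfl⟩, Matrix.SpecialLinearGroup.mem_range_toGL_iff.mpr h⟩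
    exact Subgroup.mem_bot.mp this
  · rw [eq_bot_iff]
    rintro _ ⟨⟨σ, rfl⟩, hσ⟩
    exact Subgroup.mem_bot.mpr
      (hone.mpr (h ▸ hdet.mp (Matrix.SpecialLinearGroup.mem_range_toGL_iff.mp hσ)))
  -- `det` embeds `G` in a commutative group.
  · refine isMulCommutative_iff.mpr fun g g' => hinj h ?_
    rw [map_mul, map_mul, mul_comm]
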